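/- **Setting.** Let $R$ be a reduced irreducible (crystallographic) root system with simple roots $\alpha_1,\dots,\alpha_n$, positive roots $R^+$ and highest root $\theta=\sum_i k_i\alpha_i$, acting as functionals on the $n$-dimensional real space $\mathfrak h$ that contains the coroots; let $\omega_1,\dots,\omega_n\in\mathfrak h$ be the fundamental coweights (the basis dual to the simple roots) and $P=\bigoplus_i\mathbb Z\omega_i$. For $\alpha\in R$, $k\in\mathbb Z$ put $s_{\alpha+k\delta}(x)=x-(\langle x,\alpha\rangle+k)\alpha^\vee$, the reflection in $H_{\alpha+k\delta}=\{x:\langle x,\alpha\rangle=-k\}$. Let $W$ be the affine Weyl group generated by all $s_{\alpha+k\delta}$, with Coxeter generators $s_0=s_{-\theta+\delta}$ and $s_i=s_{\alpha_i}$ $(1\le i\le n)$, and identify $w\in W$ with the alcove $w\mathfrak a$, where $\mathfrak a=\{x:\langle x,\alpha_i\rangle>0\ (1\le i\le n),\ \langle x,\theta\rangle<1\}$. For $\alpha\in R^+$ the positive side of $H_{\alpha+k\delta}$ is $\{\langle x,\alpha\rangle\ge -k\}$ and the negative side is $\{\langle x,\alpha\rangle\le -k\}$. For adjacent alcoves $x,y$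 call $x\to y$ a *positive crossing* if the hyperplane separating them has $x$ on its negative side and $y$ on its positive side, and a *negative crossing* if it is the other way round. Let $\Sigma$ be the Coxeter complex, whose simplices are the nonempty sets of vertices of an alcove; the vertices $0$ and $\omega_i/k_i$ of $\mathfrak a$ have types $0$ and $i$, and $W$ preserves types. Sectors of $\Sigma$ are the images of the Weyl chambers under $P\rtimes W_0$, where $W_0$ is the finite Weyl group; $C_0=\{x:\langle x,\alpha_i\rangle>0\text{ for }1\le i\le n\}$, and $w_0$ is the longest element of $W_0$, so that $w_0C_0=-C_0$. A *building of type $W$* is a nonempty simplicial complex $X$, each of whose simplices lies in a maximal simplex (*chamber*), with a set of subcomplexes (*apartments*) such that: each apartment is isomorphic to $\Sigma$; any two chambers lie in a common apartment; and for apartments $A,A'$ with $A\cap A'\ne\emptyset$ there is an isomorphism $A'\to A$ fixing $A\cap A'$ pointwise. Assume that the apartment system is complete, that is, every subcomplex of $X$ isomorphic to $\Sigma$ is an apartment. Fix an apartment and an isomorphism of it with $\Sigma$, and so regard $\Sigma$ as an apartment of $X$ and its alcoves $w\in W$ as chambers of $X$. The type function of $\Sigma$ extends uniquely to the vertices of $X$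 so that every chamber has exactly one vertex of each type $0,\dots,n$; a panel (codimension-one simplex) has *cotype* $i$ if it has a vertex of every type except $i$, and two chambers are *$i$-adjacent* if they share a panel of cotype $i$. Assume that $X$ is *regular*: any two panels of the same cotype are contained in equally many chambers (as cardinal numbers, possibly infinite). The retraction $\rho_{-\infty}$ sends a chamber $c$ of $X$ to $\psi(c)$, where $\psi:A\to\Sigma$ is an isomorphism fixing $A\cap\Sigma$ pointwise and $A$ is any apartment that contains $c$ and a subsector of $w_0C_0$. For each $i\in\{0,\dots,n\}$ let $\mathbf q_i$ be a set with a distinguished element $0$ that indexes the chambers $i$-adjacent to, and different from, a given chamber (by regularity its cardinality does not depend on the chamber). **Proposition.** Let $\vec w=s_{i_1}\cdots s_{i_\ell}$ be a reduced expression and let $v\in W$. Let $\mathcal G(\vec w)_v$ be the set of galleries $c_0,\dots,c_\ell$ of type $\vec w$ in $X$ (chambers with $c_{k-1}\neq c_k$ and $c_{k-1}$, $c_k$ $i_k$-adjacent for $1\le k\le\ell$) with $c_0=1\in\Sigma$ and $\rho_{-\infty}(c_\ell)=v$. Then $\mathcal G(\vec w)_v$ is in bijection with the set of $\mathbf q$-labelled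 positively folded alcove walks of type $\vec w$ ending at $v$, that is, the sequences of alcoves $1=x_0,x_1,\dots,x_\ell=v$ in $W$ with labels $z_k\in\mathbf q_{i_k}$ $(1\le k\le\ell)$ such that, for each $k$, with $x=x_{k-1}$ and $s=s_{i_k}$, one of the following holds: - (positive crossing) $x_k=xs$, $x\to xs$ is a positive crossing, and $z_k\in\mathbf q_{i_k}$ is arbitrary; - (positive fold) $x_k=x$, $x\to xs$ is a negative crossing, and $z_k\in\mathbf q_{i_k}\setminus\{0\}$; - (negative crossing) $x_k=xs$, $x\to xs$ is a negative crossing, and $z_k=0$. Moreover, the bijection can be chosen so that a gallery $c_0,\dots,c_\ell$ corresponds to a walk with alcoves $x_k=\rho_{-\infty}(c_k)$, $0\le k\le\ell$. -/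

import Mathlib

noncomputable section

namespace AffineBuilding

/-! ### The affine Weyl group and its alcoves

Throughout, `P` is a root system with roots in `M` and coroots in `N`, and `b` is a base of `P`.
The space `N` (which contains the coroots and the coweights) carries the affine hyperplane
arrangement, and a root `α` is the linear functional `P.root' α` on `N`. -/

section Geometry

variable {ι M N : Type*} [AddCommGroup M] [Module ℝ M] [AddCommGroup N] [Module ℝ N]

/-- The reflection `s_{α + kδ}` in the hyperplane `⟨x, α⟩ = -k`. -/
def affineReflection (P : RootPairing ι ℝ M N) (α : ι) (k : ℤ) : N ≃ᵃ[ℝ] N :=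
  (P.coreflection α).toAffineEquiv.trans (AffineEquiv.constVAdd ℝ N (-(k : ℝ) • P.coroot α))

theorem affineReflection_apply (P : RootPairing ι ℝ M N) (α : ι) (k : ℤ) (x : N) :
    affineReflection P α k x = x - (P.root' α x + (k : ℝ)) • P.coroot α := by
  simp only [affineReflection, AffineEquiv.trans_apply, LinearEquiv.coe_toAffineEquiv,
    AffineEquiv.constVAdd_apply, vadd_eq_add, RootPairing.coreflection_apply]
  module

/-- The affine Weyl group: the group generated by all the reflections `s_{α + kδ}`. -/
def affineWeylGroup (P : RootPairing ι ℝ M N) : Subgroup (N ≃ᵃ[ℝ] N) :=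
  Subgroup.closure (Set.range fun p : ι × ℤ => affineReflection P p.1 p.2)

/-- The (finite) Weyl group, acting linearly on `N`. -/
def finiteWeylGroup (P : RootPairing ι ℝ M N) : Subgroup (N ≃ₗ[ℝ] N) :=
  Subgroup.closure (Set.range P.coreflection)

variable {P : RootPairing ι ℝ M N}

/-- The set `{0, …, n}` of types; `none` is the type `0`, and `some i` belongs to the simple
root `α_i`. -/
abbrev Node (b : P.Base) : Type _ := Option b.support

variable [P.IsRootSystem] (b : P.Base)

/-- `θ` is a highest root: every coefficient of `θ` in the simple roots is at least the
corresponding coefficient of any root. -/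
def IsHighestRoot (θ : ι) : Prop :=
  ∀ (i : b.support) (α : ι),
    b.toWeightBasis.repr (P.root α) i ≤ b.toWeightBasis.repr (P.root θ) i

/-- The fundamental coweights: the basis of `N` dual to the simple roots. -/
def fundamentalCoweight (i : b.support) : N :=
  P.flip.toLinearMap.toPerfPair.symm (b.toWeightBasis.coord i)

theorem root'_fundamentalCoweight (i j : b.support) :
    P.root' j (fundamentalCoweight b i) = Finsupp.single j (1 : ℝ) i := by
  have h : P.flip.toLinearMap.toPerfPair (fundamentalCoweight b i) = b.toWeightBasis.coord i := by
    simp [fundamentalCoweight]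
  have h2 := LinearMap.congr_fun h (P.root j)
  rw [LinearMap.toPerfPair_apply] at h2
  simp only [Module.Basis.coord_apply, RootPairing.Base.toWeightBasis_repr_root] at h2
  simpa using h2

/-- The coweight lattice. -/
def coweightLattice : AddSubgroup N :=
  AddSubgroup.closure (Set.range (fundamentalCoweight b))

/-- The fundamental Weyl chamber `C_0`. -/
def weylChamber : Set N := {x | ∀ i : b.support, 0 < P.root' i x}

/-- The Weyl chamber `w_0 C_0` opposite to `C_0` (it equals `-C_0`). -/
def oppositeWeylChamber : Set N := {x | ∀ i : b.support, P.root' i x < 0}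

/-- Sectors: the images of Weyl chambers under the extended affine Weyl group. -/
def IsSector (T : Set N) : Prop :=
  ∃ μ ∈ coweightLattice b, ∃ u ∈ finiteWeylGroup P, T = (fun x => u x + μ) '' weylChamber b

variable [Nonempty ι]

/-- The highest root. -/
def highestRoot : ι := Classical.epsilon (IsHighestRoot b)

/-- The Coxeter generators `s_0, s_1, …, s_n` of the affine Weyl group; `s_0` is the reflection in
the hyperplane `⟨x, θ⟩ = 1`, where `θ` is the highest root. -/
def simpleReflection : Node b → affineWeylGroup P
  | none => ⟨affineReflection P (highestRoot b) (-1), Subgroup.subset_closure ⟨(_, _), rfl⟩⟩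
  | some i => ⟨affineReflection P i 0, Subgroup.subset_closure ⟨(_, _), rfl⟩⟩

/-- The element of the affine Weyl group spelled by a word in the Coxeter generators. -/
def wordProd {l : ℕ} (word : Fin l → Node b) : affineWeylGroup P :=
  (List.ofFn fun k => simpleReflection b (word k)).prod

/-- A word is reduced if no shorter word spells the same element. -/
def IsReducedWord {l : ℕ} (word : Fin l → Node b) : Prop :=
  ∀ (l' : ℕ) (word' : Fin l' → Node b), wordProd b word' = wordProd b word → l ≤ l'

/-- The fundamental alcove: `⟨x, α_i⟩ > 0` for `i = 0, …, n`, where `α_0 = -θ + δ`. -/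
def fundamentalAlcove : Set N :=
  {x | (∀ i : b.support, 0 < P.root' i x) ∧ 0 < -P.root' (highestRoot b) x + 1}

/-- The alcove corresponding to an element of the affine Weyl group. -/
def alcove (w : affineWeylGroup P) : Set N := (w : N ≃ᵃ[ℝ] N) '' fundamentalAlcove b

/-- The step from the alcove `x` to the adjacent alcove `y` is a positive crossing: some
hyperplane `H_{α + kδ}`, `α` a positive root, has `x` on its negative and `y` on its positive
side. -/
def IsPositiveCrossing (x y : affineWeylGroup P) : Prop :=
  ∃ α : ι, b.IsPos α ∧ ∃ k : ℤ,
    (∀ a ∈ alcove b x, P.root' α a + (k : ℝ) ≤ 0) ∧ (∀ a ∈ alcove b y, 0 ≤ P.root' α a + (k : ℝ))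

/-- The vertices `0` (of type `0`) and `ω_i / k_i` (of type `i`) of the fundamental alcove, where
`k_i` is the coefficient of `α_i` in the highest root. -/
def fundamentalVertex : Node b → N
  | none => 0
  | some i => (b.toWeightBasis.repr (P.root (highestRoot b)) i)⁻¹ • fundamentalCoweight b i

open Classical in
/-- The set of vertices of the alcove corresponding to `w`. -/
def alcoveVertices (w : affineWeylGroup P) : Finset N :=
  Finset.univ.image fun i : Node b => (w : N ≃ᵃ[ℝ] N) (fundamentalVertex b i)

/-- The Coxeter complex `Σ`: its simplices are the nonempty sets of vertices of an alcove. -/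
def coxeterComplex : PreAbstractSimplicialComplex N where
  faces := {s | s.Nonempty ∧ ∃ w : affineWeylGroup P, s ⊆ alcoveVertices b w}
  isRelLowerSet_faces := fun _ h =>
    ⟨h.1, fun _ hts ht => ⟨ht, h.2.imp fun _ hw => Finset.Subset.trans hts hw⟩⟩

end Geometry

/-! ### Simplicial complexes -/

section Complexes

variable {V V' : Type*}

/-- The vertices of a simplicial complex. -/
def vertices (K : PreAbstractSimplicialComplex V) : Set V := {x | {x} ∈ K}

open Classical in
/-- `f` restricts to an isomorphism of simplicial complexes from `K` to `L` (its values outside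
the vertices of `K` are irrelevant). -/
def IsSimplicialIso (K : PreAbstractSimplicialComplex V) (L : PreAbstractSimplicialComplex V')
    (f : V → V') : Prop :=
  Set.BijOn f (vertices K) (vertices L) ∧
    ∀ s : Finset V, (s : Set V) ⊆ vertices K → (s ∈ K ↔ s.image f ∈ L)

/-- The chambers of a simplicial complex are its maximal simplices. -/
def IsChamber (K : PreAbstractSimplicialComplex V) (c : Finset V) : Prop :=
  Maximal (fun s => s ∈ K) c

/-- Panels: simplices of codimension one. -/
def IsPanel (K : PreAbstractSimplicialComplex V) (p : Finset V) : Prop :=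
  p ∈ K ∧ ∃ c, IsChamber K c ∧ p ⊆ c ∧ c.card = p.card + 1

end Complexes

/-! ### Affine buildings -/

variable {ι M N : Type*} [AddCommGroup M] [Module ℝ M] [AddCommGroup N] [Module ℝ N]
  {P : RootPairing ι ℝ M N} [P.IsRootSystem] [Nonempty ι]

/-- A building, with its apartments, whose type is the affine Weyl group of `P`. -/
structure Building (b : P.Base) (V : Type*) where
  /-- the underlying simplicial complex -/
  complex : PreAbstractSimplicialComplex V
  /-- the apartments -/
  apartments : Set (PreAbstractSimplicialComplex V)
  nonempty : ∃ s, s ∈ complex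
  exists_chamber : ∀ s ∈ complex, ∃ c, IsChamber complex c ∧ s ⊆ c
  apartment_le : ∀ A ∈ apartments, A ≤ complex
  /-- every apartment is isomorphic to the Coxeter complex -/
  apartment_iso : ∀ A ∈ apartments, ∃ f : N → V, IsSimplicialIso (coxeterComplex b) A f
  /-- any two chambers lie in a common apartment -/
  exists_apartment : ∀ c d, IsChamber complex c → IsChamber complex d →
    ∃ A ∈ apartments, c ∈ A ∧ d ∈ A
  /-- intersecting apartments are isomorphic by a map that fixes their intersection -/
  exists_iso : ∀ A ∈ apartments, ∀ A' ∈ apartments, (∃ s, s ∈ A ⊓ A') →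
    ∃ f : V → V, IsSimplicialIso A' A f ∧ ∀ x ∈ vertices (A ⊓ A'), f x = x

namespace Building

variable {b : P.Base} {V : Type*}

/-- The system of apartments is the complete one: every subcomplex isomorphic to the Coxeter
complex is an apartment. -/
def IsComplete (X : Building b V) : Prop :=
  ∀ A ≤ X.complex, (∃ f : N → V, IsSimplicialIso (coxeterComplex b) A f) → A ∈ X.apartments

/-- An apartment of `X` together with an identification of the Coxeter complex with it. -/
structure Marking (X : Building b V) where
  /-- the fixed apartment -/
  apartment : PreAbstractSimplicialComplex V
  mem_apartments : apartment ∈ X.apartments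
  /-- the isomorphism from the Coxeter complex to the fixed apartment -/
  emb : N → V
  isSimplicialIso : IsSimplicialIso (coxeterComplex b) apartment emb

namespace Marking

variable {X : Building b V} (m : X.Marking)

open Classical in
/-- The chamber of the fixed apartment that corresponds to `w`. -/
def chamberAt (w : affineWeylGroup P) : Finset V := (alcoveVertices b w).image m.emb

/-- `τ` extends the type function of the Coxeter complex, and every chamber has exactly one vertex
of each type. -/
def IsTypeFunction (τ : V → Node b) : Prop :=
  (∀ (w : affineWeylGroup P) (i : Node b),
    τ (m.emb ((w : N ≃ᵃ[ℝ] N) (fundamentalVertex b i))) = i) ∧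
  ∀ c, IsChamber X.complex c → Set.BijOn τ c Set.univ

open Classical in
/-- The type function on the vertices of the building (the unique one, on vertices, that
satisfies `IsTypeFunction`). -/
def typeFunction : V → Node b :=
  if h : ∃ τ, m.IsTypeFunction τ then h.choose else fun _ => none

/-- The simplex `p` has vertices of all types except `i`. -/
def HasCotype (p : Finset V) (i : Node b) : Prop :=
  ∀ j, (∃ x ∈ p, m.typeFunction x = j) ↔ j ≠ i

/-- The building is regular: panels of the same cotype lie in equally many chambers. -/
def IsRegular : Prop :=
  ∀ (i : Node b) (p p' : Finset V), IsPanel X.complex p → IsPanel X.complex p' →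
    m.HasCotype p i → m.HasCotype p' i →
    Nonempty ({c // IsChamber X.complex c ∧ p ⊆ c} ≃ {c // IsChamber X.complex c ∧ p' ⊆ c})

/-- The chambers `c` and `d` share a panel of cotype `i`. -/
def Adjacent (i : Node b) (c d : Finset V) : Prop :=
  IsChamber X.complex c ∧ IsChamber X.complex d ∧
    ∃ p, IsPanel X.complex p ∧ m.HasCotype p i ∧ p ⊆ c ∧ p ⊆ d

/-- The chambers `d` with `δ(c, d) = s_i`. -/
def neighbors (i : Node b) (c : Finset V) : Set (Finset V) := {d | m.Adjacent i c d ∧ c ≠ d}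

/-- Galleries of a given type. -/
def IsGallery {l : ℕ} (word : Fin l → Node b) (c : Fin (l + 1) → Finset V) : Prop :=
  (∀ k, IsChamber X.complex (c k)) ∧
    ∀ k : Fin l, m.Adjacent (word k) (c k.castSucc) (c k.succ) ∧ c k.castSucc ≠ c k.succ

/-- The subcomplex `A` contains the part of the fixed apartment that corresponds to the
sector `T`. -/
def ContainsSector (A : PreAbstractSimplicialComplex V) (T : Set N) : Prop :=
  ∀ w : affineWeylGroup P, alcove b w ⊆ T → m.chamberAt w ∈ A

open Classical in
/-- `w` is the image of the chamber `c` under the retraction onto the fixed apartment centred at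
the sector `w_0 C_0`, computed by means of some apartment `A` that contains `c` and a subsector of
`w_0 C_0`. -/
def RetractsTo (c : Finset V) (w : affineWeylGroup P) : Prop :=
  ∃ A ∈ X.apartments, c ∈ A ∧
    (∃ T, IsSector b T ∧ T ⊆ oppositeWeylChamber b ∧ m.ContainsSector A T) ∧
    ∃ f : V → V, IsSimplicialIso A m.apartment f ∧
      (∀ x ∈ vertices (A ⊓ m.apartment), f x = x) ∧ c.image f = m.chamberAt w

open Classical in
/-- The sector retraction `ρ_{-∞}`, from chambers of the building to alcoves. -/
def retraction (c : Finset V) : affineWeylGroup P :=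
  if h : ∃ w, m.RetractsTo c w then h.choose else 1

/-- The galleries of type `word` that start at the chamber `1` and whose last chamber retracts
to `v`. -/
def galleries {l : ℕ} (word : Fin l → Node b) (v : affineWeylGroup P) :
    Set (Fin (l + 1) → Finset V) :=
  {c | m.IsGallery word c ∧ c 0 = m.chamberAt 1 ∧ m.retraction (c (Fin.last l)) = v}

end Marking

end Building

/-! ### Labelled alcove walks -/

/-- One step of type `i` of a labelled positively folded alcove walk, from the alcove `x` to the
alcove `y`, with label `z`: a positive crossing with any label, a positive fold with a nonzero
label, or a negative crossing with label `0`. -/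
def IsLabelledStep (b : P.Base) (q : Node b → Type*) [∀ i, Zero (q i)] (i : Node b)
    (x y : affineWeylGroup P) (z : q i) : Prop :=
  (y = x * simpleReflection b i ∧ IsPositiveCrossing b x (x * simpleReflection b i)) ∨
  (y = x ∧ IsPositiveCrossing b (x * simpleReflection b i) x ∧ z ≠ 0) ∨
  (y = x * simpleReflection b i ∧ IsPositiveCrossing b (x * simpleReflection b i) x ∧ z = 0)

/-- The `q`-labelled positively folded alcove walks of type `word` from the alcove `1` to the
alcove `v`. -/
structure LabelledWalk (b : P.Base) (q : Node b → Type*) [∀ i, Zero (q i)] {l : ℕ}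
    (word : Fin l → Node b) (v : affineWeylGroup P) where
  /-- the alcoves -/
  alcove : Fin (l + 1) → affineWeylGroup P
  /-- the labels -/
  label : ∀ k : Fin l, q (word k)
  start : alcove 0 = 1
  finish : alcove (Fin.last l) = v
  step : ∀ k : Fin l, IsLabelledStep b q (word k) (alcove k.castSucc) (alcove k.succ) (label k)

end AffineBuilding

end

/-! A gallery of fixed type is a sequence of choices of neighbours, so the bijection can be built
one step at a time. It suffices to label, for each chamber `c` and type `i`, the `i`-neighbours of
`c` by `q i` so that the retraction of a neighbour is determined by `x = ρ(c)` and its label,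
according to the rules of a labelled step (`exists_labelling`). Reading off labels then turns
galleries into walks. Conversely, a walk prescribes the neighbour to take at every step, and its
alcoves are forced by its labels (`IsLabelledStep.unique`).

The local statement is about one wall, that between `x` and `xs`. Choose an apartment through `c`
that contains a subsector of `w_0 C_0`. Deep in that sector every positive root is very negative, so
a positive crossing `x → xs` means that the sector eventually lies on the side of `x`. In that case
every `i`-neighbour `d` of `c` is one step further from all chambers on that side, so `d` together
with the half-apartment is isometric to a subset of `W`; the isometry extends to an apartment, and
`d` retracts to `xs` (`RetractsAlong.of_sameSide`). If the crossing is negative, the chamber `c'` at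
`xs` in the apartment retracts to `xs`; every other neighbour of `c` is also a neighbour of `c'`,
and the first case applied to `c'` sends it back to `x` (`RetractsAlong.exists_of_not_sameSide`).
The neighbour `c'` receives the label `0`, all others nonzero labels.

Three things support this. The root system yields the Coxeter combinatorics of `W`: a wall separates
alcoves exactly when reflecting shortens, and strong exchange holds (`eq_wall_of_separates`,
`strong_exchange`). The simplicial axioms yield a `W`-valued distance on chambers, for which partial
isometries from `W` extend (`isWeylDistance`, `IsWeylDistance.exists_isometry`). Completeness turns
isometries from `W` into apartments (`exists_isTypedChart_of_isIsometry`), so the simplicial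
retraction agrees with the metric one (`retractsTo_iff`). -/

noncomputable section

namespace AffineBuilding

set_option linter.unusedSectionVars false

/-! ### Root coefficients and the highest root -/

section Roots

variable {ι M N : Type*} [AddCommGroup M] [Module ℝ M] [AddCommGroup N] [Module ℝ N]
  {P : RootPairing ι ℝ M N} [P.IsRootSystem] (b : P.Base)

/-- The coefficient of the root `α` in the simple root `i`. -/
def coeff (α : ι) (i : b.support) : ℝ := b.toWeightBasis.repr (P.root α) i

theorem sum_coeff_smul_root (α : ι) : ∑ i, coeff b α i • P.root i = P.root α := by
  simpa [coeff] using b.toWeightBasis.sum_repr (P.root α)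

theorem root'_eq_sum_coeff (α : ι) (x : N) :
    P.root' α x = ∑ i, coeff b α i * P.root' i x := by
  rw [RootPairing.root', ← sum_coeff_smul_root b α]
  simp

theorem coeff_eq_of_root_eq_sum {α : ι} {f : ι → ℤ}
    (h : P.root α = ∑ j ∈ b.support, f j • P.root j) (i : b.support) :
    coeff b α i = f i := by
  have h2 : P.root α = ∑ j : b.support, (f j : ℝ) • b.toWeightBasis j := by
    rw [h, ← b.support.sum_coe_sort]
    exact Finset.sum_congr rfl fun j _ => by simp [Int.cast_smul_eq_zsmul]
  rw [coeff, h2, Module.Basis.repr_sum_self]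

theorem exists_coeff_eq (α : ι) :
    ∃ f : b.support → ℤ, (∀ i, coeff b α i = f i) ∧ b.height α = ∑ i, f i ∧
      ((∀ i, 0 ≤ f i) ∨ ∀ i, f i ≤ 0) := by
  obtain ⟨f, -, hs, h⟩ := b.exists_root_eq_sum_int α
  refine ⟨fun i => f i, coeff_eq_of_root_eq_sum b h, ?_, ?_⟩
  · rw [RootPairing.Base.height_eq_sum h, ← b.support.sum_coe_sort]
  · exact hs.imp (fun h i => h.le i) (fun h i => h.le i)

variable {b} in
theorem coeff_nonneg {α : ι} (h : b.IsPos α) (i : b.support) : 0 ≤ coeff b α i := by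
  obtain ⟨f, hf, hh, h1 | h1⟩ := exists_coeff_eq b α
  · rw [hf]; exact_mod_cast h1 i
  · rw [RootPairing.Base.isPos_iff, hh] at h
    exact absurd h (Finset.sum_nonpos fun i _ => h1 i).not_gt

variable {b} in
theorem exists_one_le_coeff {α : ι} (h : b.IsPos α) : ∃ i : b.support, 1 ≤ coeff b α i := by
  obtain ⟨f, hf, hh, -⟩ := exists_coeff_eq b α
  rw [RootPairing.Base.isPos_iff, hh] at h
  obtain ⟨i, -, hi⟩ := Finset.exists_lt_of_sum_lt (s := Finset.univ) (f := fun _ : b.support => (0 : ℤ))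
    (by simpa using h)
  exact ⟨i, by rw [hf]; exact_mod_cast hi⟩

theorem coeff_reflectionPerm_self (α : ι) (i : b.support) :
    coeff b (P.reflectionPerm α α) i = -coeff b α i := by
  simp [coeff]

theorem isPos_reflectionPerm_self_iff (α : ι) :
    b.IsPos (P.reflectionPerm α α) ↔ ¬ b.IsPos α :=
  RootPairing.Base.IsPos.neg_iff_not b α

theorem coeff_simple (i j : b.support) : coeff b i j = Finsupp.single i (1 : ℝ) j := by
  simp [coeff]

theorem root_eq_of_coeff_eq {α β : ι} (h : ∀ i, coeff b α i = coeff b β i) : α = β := by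
  apply P.root.injective
  rw [← sum_coeff_smul_root b α, ← sum_coeff_smul_root b β]
  simp [h]

theorem pairing_eq_intCast [P.IsCrystallographic] (i j : ι) :
    P.pairing i j = (P.pairingIn ℤ i j : ℝ) := by
  rw [← P.algebraMap_pairingIn ℤ, eq_intCast]

section Highest

variable [Finite ι] [P.IsCrystallographic] [P.IsReduced]

/-- `θ` is maximal for the coefficientwise order on roots. -/
def IsMaximalRoot (θ : ι) : Prop := ∀ β, (∀ i, coeff b θ i ≤ coeff b β i) → β = θ

theorem exists_isMaximalRoot_ge (α : ι) :
    ∃ θ, IsMaximalRoot b θ ∧ ∀ i, coeff b α i ≤ coeff b θ i := by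
  obtain ⟨v, hv, ⟨θ, rfl⟩, hm⟩ :=
    (Set.finite_range (coeff b)).exists_le_maximal (Set.mem_range_self α)
  exact ⟨θ, fun β hβ => root_eq_of_coeff_eq b fun i => le_antisymm (hm ⟨β, rfl⟩ hβ i) (hβ i), hv⟩

variable {b}

theorem IsMaximalRoot.isPos {θ : ι} (h : IsMaximalRoot b θ) : b.IsPos θ := by
  by_contra hn
  have hp := (isPos_reflectionPerm_self_iff b θ).2 hn
  have := h (P.reflectionPerm θ θ) fun i => by
    have := coeff_nonneg hp i
    rw [coeff_reflectionPerm_self] at this ⊢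
    linarith
  rw [this] at hp
  exact hn hp

/-- Otherwise `θ + α_j` would be a root above `θ`. -/
theorem IsMaximalRoot.pairingIn_nonneg {θ : ι} (h : IsMaximalRoot b θ) {j : ι}
    (hj : j ∈ b.support) : 0 ≤ P.pairingIn ℤ θ j := by
  by_contra! hn
  have hne : P.root θ ≠ -P.root j := by
    intro he
    have h1 : θ = P.reflectionPerm j j := P.root.injective (by simp [he])
    have := h.isPos
    rw [h1, isPos_reflectionPerm_self_iff] at this
    exact this (RootPairing.Base.isPos_of_mem_support hj)
  obtain ⟨β, hβ⟩ := P.root_add_root_mem_of_pairingIn_neg hn hne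
  have hc : ∀ i, coeff b β i = coeff b θ i + coeff b j i := fun i => by
    simp [coeff, hβ]
  have := h β fun i => by
    have := coeff_nonneg (RootPairing.Base.isPos_of_mem_support hj) i
    rw [hc]; linarith
  subst this
  exact P.ne_zero j (by simpa using hβ)

theorem pairing_eq_sum_coeff (α j : ι) :
    P.pairing α j = ∑ i : b.support, coeff b α i * P.pairing i j := by
  have := root'_eq_sum_coeff b α (P.coroot j)
  simpa using this

variable [P.IsIrreducible]

/-- Irreducibility: the span of the simple roots occurring in `θ` is stable under every simple
reflection, hence is everything. -/
theorem IsMaximalRoot.coeff_pos {θ : ι} (h : IsMaximalRoot b θ) (i : b.support) :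
    0 < coeff b θ i := by
  let J : Set b.support := {i | 0 < coeff b θ i}
  let q : Submodule ℝ M := Submodule.span ℝ ((fun i : b.support => P.root i) '' J)
  have hinv : ∀ j ∈ b.support, q ∈ Module.End.invtSubmodule (P.reflection j) := by
    intro j hj
    rw [Module.End.mem_invtSubmodule]
    refine Submodule.span_le.2 ?_
    rintro _ ⟨k, hk, rfl⟩
    change P.reflection j (P.root k) ∈ q
    rw [RootPairing.reflection_apply_root]
    have hkq : P.root k ∈ q := Submodule.subset_span ⟨k, hk, rfl⟩
    refine q.sub_mem hkq ?_
    by_cases hjJ : (⟨j, hj⟩ : b.support) ∈ J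
    · exact q.smul_mem _ (Submodule.subset_span ⟨⟨j, hj⟩, hjJ, rfl⟩)
    · have hle : ∀ i : b.support, i ∈ J → P.pairing i j ≤ 0 := by
        intro i hi
        rw [pairing_eq_intCast]
        have : P.pairingIn ℤ i j ≤ 0 := b.pairingIn_le_zero_of_ne
          (fun he => hjJ (by convert hi using 1; exact Subtype.ext he.symm)) i.2 hj
        exact_mod_cast this
      -- For `j` outside the support of `θ`, the pairing of `θ` with `α_j^∨` is nonnegative but is a
      -- sum of nonpositive terms. All terms vanish, so `α_j` is orthogonal to the support.
      have hsum : 0 ≤ ∑ i : b.support, coeff b θ i * P.pairing i j := by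
        rw [← pairing_eq_sum_coeff, pairing_eq_intCast]
        exact_mod_cast h.pairingIn_nonneg hj
      have hterm : ∀ i ∈ Finset.univ, coeff b θ i * P.pairing i j ≤ 0 := by
        intro i _
        by_cases hi : i ∈ J
        · exact mul_nonpos_of_nonneg_of_nonpos (le_of_lt hi) (hle i hi)
        · have : coeff b θ i = 0 := le_antisymm (not_lt.1 hi) (coeff_nonneg h.isPos i)
          simp [this]
      have h0 := (Finset.sum_eq_zero_iff_of_nonpos hterm).1
        (le_antisymm (Finset.sum_nonpos hterm) hsum) k (Finset.mem_univ _)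
      have hk0 : P.pairing k j = 0 := (mul_eq_zero.1 h0).resolve_left (ne_of_gt hk)
      simp [hk0]
  have hq : q = ⊤ := by
    refine RootPairing.IsIrreducible.eq_top_of_invtSubmodule_reflection (P := P) q
      ((b.forall_mem_support_invtSubmodule_iff q).1 hinv) ?_
    obtain ⟨k, hk⟩ := exists_one_le_coeff h.isPos
    intro hb
    have hkq : P.root k ∈ q := Submodule.subset_span ⟨k, lt_of_lt_of_le one_pos hk, rfl⟩
    rw [hb, Submodule.mem_bot] at hkq
    exact P.ne_zero k hkq
  by_contra hi
  have := b.toWeightBasis.linearIndependent.notMem_span_image (s := J) (x := i) hi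
  simp only [RootPairing.Base.toWeightBasis_apply] at this
  change P.root i ∉ q at this
  exact this (hq ▸ Submodule.mem_top)

/-- Two distinct maximal roots would pair positively, since all coefficients of `θ` are positive.
Their difference would then be a root, positive or negative, making one of them larger than the
other. -/
theorem IsMaximalRoot.eq {θ θ' : ι} (h : IsMaximalRoot b θ) (h' : IsMaximalRoot b θ') :
    θ = θ' := by
  by_contra hne
  have hpos : 0 < P.pairing θ θ' := by
    rw [pairing_eq_sum_coeff (b := b)]
    have hnn : ∀ i : b.support, 0 ≤ P.pairing i θ' := by
      intro i
      rw [pairing_eq_intCast]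
      have h1 := h'.pairingIn_nonneg i.2
      have : 0 ≤ P.pairingIn ℤ i θ' := by
        by_contra! hn
        exact absurd ((P.pairingIn_lt_zero_iff ℤ).1 hn) h1.not_gt
      exact_mod_cast this
    obtain ⟨j, hj, hj'⟩ := h'.isPos.exists_mem_support_pos_pairingIn
    refine Finset.sum_pos' (fun i _ => mul_nonneg (h.coeff_pos i).le (hnn i))
      ⟨⟨j, hj⟩, Finset.mem_univ _, mul_pos (h.coeff_pos _) ?_⟩
    rw [pairing_eq_intCast]
    exact_mod_cast hj'
  have hpos' : 0 < P.pairingIn ℤ θ θ' := by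
    rw [pairing_eq_intCast] at hpos
    exact_mod_cast hpos
  obtain ⟨γ, hγ⟩ := P.root_sub_root_mem_of_pairingIn_pos hpos' hne
  have hc : ∀ i, coeff b γ i = coeff b θ i - coeff b θ' i := fun i => by simp [coeff, hγ]
  by_cases hp : b.IsPos γ
  · exact hne (h' θ fun i => by have := coeff_nonneg hp i; rw [hc] at this; linarith)
  · refine hne (h θ' fun i => ?_).symm
    have := coeff_nonneg ((isPos_reflectionPerm_self_iff b γ).2 hp) i
    rw [coeff_reflectionPerm_self, hc] at this
    linarith

variable (b) [Nonempty ι]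

/-- `highestRoot` is a choice, so existence is needed: every root lies below some maximal root, and
there is only one. -/
theorem isHighestRoot_highestRoot : IsHighestRoot b (highestRoot b) := by
  refine Classical.epsilon_spec (p := IsHighestRoot b) ?_
  obtain ⟨θ, hθ, -⟩ := exists_isMaximalRoot_ge b (Classical.arbitrary ι)
  refine ⟨θ, fun i α => ?_⟩
  obtain ⟨θ', hθ', h⟩ := exists_isMaximalRoot_ge b α
  exact hθ.eq hθ' ▸ h i

theorem coeff_le_coeff_highestRoot (α : ι) (i : b.support) :
    coeff b α i ≤ coeff b (highestRoot b) i := isHighestRoot_highestRoot b i α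

theorem one_le_coeff_highestRoot (i : b.support) : 1 ≤ coeff b (highestRoot b) i := by
  simpa [coeff_simple] using coeff_le_coeff_highestRoot b i i

theorem isPos_highestRoot : b.IsPos (highestRoot b) := by
  by_contra h
  obtain ⟨i, hi⟩ := exists_one_le_coeff ((isPos_reflectionPerm_self_iff b _).2 h)
  rw [coeff_reflectionPerm_self] at hi
  have := one_le_coeff_highestRoot b i
  linarith

end Highest

end Roots

end AffineBuilding

end

noncomputable section

namespace AffineBuilding

set_option linter.unusedSectionVars false

/-! ### Affine roots and their reflections -/

section AffineRoots

variable {ι M N : Type*} [AddCommGroup M] [Module ℝ M] [AddCommGroup N] [Module ℝ N]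

/-- The value at `x` of the affine root `α + kδ`, where `f = (α, k)`. -/
def affEval (P : RootPairing ι ℝ M N) (f : ι × ℤ) (x : N) : ℝ := P.root' f.1 x + (f.2 : ℝ)

/-- The reflection in the zero set of an affine root, as an element of the affine Weyl group. -/
def reflOf (P : RootPairing ι ℝ M N) (f : ι × ℤ) : affineWeylGroup P :=
  ⟨affineReflection P f.1 f.2, Subgroup.subset_closure ⟨f, rfl⟩⟩

variable {P : RootPairing ι ℝ M N}

theorem root'_reflectionPerm_self (α : ι) (x : N) :
    P.root' (P.reflectionPerm α α) x = -P.root' α x := by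
  simp [RootPairing.root']

theorem reflOf_apply (f : ι × ℤ) (x : N) :
    (reflOf P f : N ≃ᵃ[ℝ] N) x = x - affEval P f x • P.coroot f.1 :=
  affineReflection_apply P f.1 f.2 x

theorem coe_mul_apply (v w : affineWeylGroup P) (x : N) :
    ((v * w : affineWeylGroup P) : N ≃ᵃ[ℝ] N) x = (v : N ≃ᵃ[ℝ] N) ((w : N ≃ᵃ[ℝ] N) x) := rfl

theorem coe_one_apply (x : N) : ((1 : affineWeylGroup P) : N ≃ᵃ[ℝ] N) x = x := rfl

theorem coe_inv_apply_self (w : affineWeylGroup P) (x : N) :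
    ((w⁻¹ : affineWeylGroup P) : N ≃ᵃ[ℝ] N) ((w : N ≃ᵃ[ℝ] N) x) = x := by
  rw [← coe_mul_apply, inv_mul_cancel, coe_one_apply]

theorem weyl_ext {v w : affineWeylGroup P}
    (h : ∀ x, (v : N ≃ᵃ[ℝ] N) x = (w : N ≃ᵃ[ℝ] N) x) : v = w :=
  Subtype.ext (AffineEquiv.ext h)

theorem affEval_sub_smul (f : ι × ℤ) (x y : N) (c : ℝ) :
    affEval P f (x - c • y) = affEval P f x - c * P.root' f.1 y := by
  simp [affEval]; ring

theorem affEval_lineMap (f : ι × ℤ) (x y : N) (t : ℝ) :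
    affEval P f (x + t • (y - x)) = (1 - t) * affEval P f x + t * affEval P f y := by
  simp [affEval]; ring

theorem affEval_reflOf_self (f : ι × ℤ) (x : N) :
    affEval P f ((reflOf P f : N ≃ᵃ[ℝ] N) x) = -affEval P f x := by
  rw [reflOf_apply, affEval_sub_smul, RootPairing.root'_coroot_eq_pairing,
    RootPairing.pairing_same]
  ring

theorem reflOf_mul_self (f : ι × ℤ) : reflOf P f * reflOf P f = 1 := by
  refine weyl_ext fun x => ?_
  rw [coe_mul_apply, coe_one_apply, reflOf_apply, affEval_reflOf_self, reflOf_apply]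
  module

/-- The opposite affine root. -/
def negRoot (P : RootPairing ι ℝ M N) (f : ι × ℤ) : ι × ℤ := (P.reflectionPerm f.1 f.1, -f.2)

theorem affEval_negRoot (f : ι × ℤ) (x : N) :
    affEval P (negRoot P f) x = -affEval P f x := by
  simp only [affEval, negRoot, root'_reflectionPerm_self, Int.cast_neg]; ring

theorem reflOf_negRoot (f : ι × ℤ) : reflOf P (negRoot P f) = reflOf P f := by
  refine weyl_ext fun x => ?_
  rw [reflOf_apply, reflOf_apply, affEval_negRoot]
  simp [negRoot]

variable [P.IsCrystallographic]

/-- The image of the affine root `f` under the reflection in the zero set of `h`. -/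
def reflRoot (P : RootPairing ι ℝ M N) [P.IsCrystallographic] (h f : ι × ℤ) : ι × ℤ :=
  (P.reflectionPerm h.1 f.1, f.2 - h.2 * P.pairingIn ℤ f.1 h.1)

theorem affEval_reflRoot (h f : ι × ℤ) (x : N) :
    affEval P (reflRoot P h f) x = affEval P f ((reflOf P h : N ≃ᵃ[ℝ] N) x) := by
  rw [reflOf_apply, affEval_sub_smul, RootPairing.root'_coroot_eq_pairing]
  simp only [affEval, reflRoot, RootPairing.root', RootPairing.root_reflectionPerm,
    RootPairing.reflection_apply_root, map_sub, map_smul, LinearMap.sub_apply,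
    LinearMap.smul_apply, smul_eq_mul, Int.cast_sub, Int.cast_mul]
  rw [← eq_intCast (algebraMap ℤ ℝ) (P.pairingIn ℤ f.1 h.1), P.algebraMap_pairingIn ℤ]
  ring

theorem reflRoot_injective (h : ι × ℤ) : Function.Injective (reflRoot P h) := by
  rintro ⟨α, k⟩ ⟨β, l⟩ hf
  simp only [reflRoot, Prod.mk.injEq, EmbeddingLike.apply_eq_iff_eq] at hf
  obtain ⟨rfl, h2⟩ := hf
  simpa using h2

theorem reflOf_reflRoot (h f : ι × ℤ) :
    reflOf P (reflRoot P h f) = reflOf P h * reflOf P f * reflOf P h := by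
  refine weyl_ext fun x => ?_
  rw [coe_mul_apply, coe_mul_apply, reflOf_apply (reflRoot P h f), affEval_reflRoot,
    reflOf_apply f]
  set y := (reflOf P h : N ≃ᵃ[ℝ] N) x with hy
  have hx : x = (reflOf P h : N ≃ᵃ[ℝ] N) y := by
    rw [hy, ← coe_mul_apply, reflOf_mul_self, coe_one_apply]
  rw [reflOf_apply h, affEval_sub_smul, hx, reflOf_apply h]
  simp only [reflRoot, RootPairing.coroot_reflectionPerm, RootPairing.coreflection_apply]
  module

/-- The group permutes affine roots, by integrality of the pairings, and conjugates reflections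
accordingly. This moves any question about a hyperplane and the alcove of `w` to the fundamental
alcove. -/
theorem exists_pullback (w : affineWeylGroup P) (f : ι × ℤ) :
    ∃ g, (∀ x, affEval P g x = affEval P f ((w : N ≃ᵃ[ℝ] N) x)) ∧
      reflOf P g = w⁻¹ * reflOf P f * w := by
  obtain ⟨w, hw⟩ := w
  induction hw using Subgroup.closure_induction'' generalizing f with
  | mem w hw =>
    obtain ⟨h, rfl⟩ := hw
    refine ⟨reflRoot P h f, affEval_reflRoot h f, ?_⟩
    change _ = (reflOf P h)⁻¹ * _ * reflOf P h
    rw [reflOf_reflRoot, inv_eq_of_mul_eq_one_left (reflOf_mul_self h)]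
  | inv_mem w hw =>
    obtain ⟨h, rfl⟩ := hw
    have hinv : (reflOf P h)⁻¹ = reflOf P h := inv_eq_of_mul_eq_one_left (reflOf_mul_self h)
    refine ⟨reflRoot P h f, fun x => ?_, ?_⟩
    · change _ = affEval P f (((reflOf P h)⁻¹ : affineWeylGroup P).1 x)
      rw [hinv]
      exact affEval_reflRoot h f x
    · change _ = ((reflOf P h)⁻¹)⁻¹ * _ * (reflOf P h)⁻¹
      rw [reflOf_reflRoot, hinv, hinv]
  | one => exact ⟨f, fun x => rfl, by
      change _ = (1 : affineWeylGroup P)⁻¹ * _ * (1 : affineWeylGroup P); simp⟩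
  | mul v w hv hw ihv ihw =>
    obtain ⟨g, hg, hg'⟩ := ihv f
    obtain ⟨k, hk, hk'⟩ := ihw g
    refine ⟨k, fun x => ?_, ?_⟩
    · rw [hk, hg]; rfl
    · rw [hk', hg']
      change _ = ((⟨v, hv⟩ : affineWeylGroup P) * ⟨w, hw⟩)⁻¹ * _ *
        ((⟨v, hv⟩ : affineWeylGroup P) * ⟨w, hw⟩)
      group

end AffineRoots

end AffineBuilding

end

noncomputable section

namespace AffineBuilding

set_option linter.unusedSectionVars false

/-! ### Geometry of the fundamental alcove -/

section Alcoves

variable {ι M N : Type*} [AddCommGroup M] [Module ℝ M] [AddCommGroup N] [Module ℝ N]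
  {P : RootPairing ι ℝ M N} [P.IsRootSystem] (b : P.Base)
  [Finite ι] [P.IsCrystallographic] [P.IsReduced] [P.IsIrreducible] [Nonempty ι]

/-- The affine roots `α_0 = -θ + δ, α_1, …, α_n`. -/
def wall : Node b → ι × ℤ
  | none => (P.reflectionPerm (highestRoot b) (highestRoot b), 1)
  | some i => (i, 0)

/-- The coefficients of the highest root; the coefficient at the node `0` is `1`. -/
def mark : Node b → ℝ
  | none => 1
  | some i => coeff b (highestRoot b) i

theorem mark_pos (i : Node b) : 0 < mark b i := by
  cases i with
  | none => exact one_pos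
  | some i => exact lt_of_lt_of_le one_pos (one_le_coeff_highestRoot b i)

theorem affEval_wall_none (x : N) :
    affEval P (wall b none) x = 1 - P.root' (highestRoot b) x := by
  simp only [affEval, wall, root'_reflectionPerm_self]; push_cast; ring

theorem affEval_wall_some (i : b.support) (x : N) :
    affEval P (wall b (some i)) x = P.root' i x := by
  simp [affEval, wall]

theorem simpleReflection_eq_reflOf (i : Node b) : simpleReflection b i = reflOf P (wall b i) := by
  cases i with
  | none =>
    have : wall b none = negRoot P (highestRoot b, -1) := by simp [wall, negRoot]
    rw [this, reflOf_negRoot]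
    rfl
  | some i => rfl

theorem simpleReflection_mul_self (i : Node b) :
    simpleReflection b i * simpleReflection b i = 1 := by
  rw [simpleReflection_eq_reflOf, reflOf_mul_self]

theorem mem_fundamentalAlcove_iff (x : N) :
    x ∈ fundamentalAlcove b ↔ ∀ i, 0 < affEval P (wall b i) x := by
  rw [Option.forall, affEval_wall_none]
  simp only [affEval_wall_some]
  rw [and_comm, show 1 - P.root' (highestRoot b) x = -P.root' (highestRoot b) x + 1 by ring]
  rfl

theorem root'_fundamentalCoweight_eq_coeff (α : ι) (i : b.support) :
    P.root' α (fundamentalCoweight b i) = coeff b α i := by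
  classical
  rw [root'_eq_sum_coeff b]
  simp [root'_fundamentalCoweight, Finsupp.single_apply]

theorem affEval_fundamentalVertex_none (f : ι × ℤ) :
    affEval P f (fundamentalVertex b none) = f.2 := by
  simp [affEval, fundamentalVertex]

theorem affEval_fundamentalVertex_some (f : ι × ℤ) (i : b.support) :
    affEval P f (fundamentalVertex b (some i)) =
      (mark b (some i))⁻¹ * coeff b f.1 i + f.2 := by
  simp only [affEval, fundamentalVertex, map_smul, root'_fundamentalCoweight_eq_coeff, smul_eq_mul]
  rfl

/-- The numbers `mark b i * affEval P (wall b i) x` are the barycentric coordinates of `x` with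
respect to the vertices of the alcove. They sum to `1` because the marks are the coefficients of
`θ`. -/
theorem affEval_eq_sum (f : ι × ℤ) (x : N) :
    affEval P f x =
      ∑ i, affEval P f (fundamentalVertex b i) * (mark b i * affEval P (wall b i) x) := by
  rw [Fintype.sum_option, affEval_fundamentalVertex_none, affEval_wall_none]
  have h : ∀ i : b.support, affEval P f (fundamentalVertex b (some i)) *
      (mark b (some i) * affEval P (wall b (some i)) x) =
      coeff b f.1 i * P.root' i x + f.2 * (coeff b (highestRoot b) i * P.root' i x) := by
    intro i
    have := (mark_pos b (some i)).ne'
    rw [affEval_fundamentalVertex_some, affEval_wall_some]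
    change _ = _ + _ * (mark b (some i) * _)
    field_simp
  simp only [h, Finset.sum_add_distrib, ← Finset.mul_sum, ← root'_eq_sum_coeff]
  simp only [affEval, mark]
  ring

theorem affEval_wall_fundamentalVertex_of_ne {i j : Node b} (h : i ≠ j) :
    affEval P (wall b i) (fundamentalVertex b j) = 0 := by
  cases i with
  | none =>
    cases j with
    | none => exact absurd rfl h
    | some j =>
      have := (mark_pos b (some j)).ne'
      rw [affEval_fundamentalVertex_some]
      simp only [wall, coeff_reflectionPerm_self]
      change _ * -mark b (some j) + _ = _
      field_simp
      simp
  | some i =>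
    cases j with
    | none => simp [affEval_fundamentalVertex_none, wall]
    | some j =>
      have hij : i ≠ j := fun e => h (by rw [e])
      rw [affEval_fundamentalVertex_some]
      simp [wall, coeff_simple, hij]

theorem affEval_wall_fundamentalVertex_self (i : Node b) :
    affEval P (wall b i) (fundamentalVertex b i) = (mark b i)⁻¹ := by
  cases i with
  | none => rw [affEval_fundamentalVertex_none]; simp [wall, mark]
  | some i =>
    rw [affEval_fundamentalVertex_some]
    simp [wall, coeff_simple]

/-- A point of the fundamental alcove. -/
def basePoint : N :=
  ∑ i, (1 + ∑ j, coeff b (highestRoot b) j)⁻¹ • fundamentalCoweight b i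

theorem basePoint_mem : basePoint b ∈ fundamentalAlcove b := by
  have hs : 0 ≤ ∑ j, coeff b (highestRoot b) j :=
    Finset.sum_nonneg fun j _ => coeff_nonneg (isPos_highestRoot b) j
  have hr : ∀ α, P.root' α (basePoint b) =
      (1 + ∑ j, coeff b (highestRoot b) j)⁻¹ * ∑ j, coeff b α j := by
    intro α
    simp only [basePoint, map_sum, map_smul, root'_fundamentalCoweight_eq_coeff, smul_eq_mul,
      Finset.mul_sum]
  rw [mem_fundamentalAlcove_iff]
  intro i
  cases i with
  | none =>
    rw [affEval_wall_none, hr, sub_pos, inv_mul_lt_one₀ (by linarith)]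
    linarith
  | some i =>
    rw [affEval_wall_some, hr]
    simp only [coeff_simple]
    classical
    simp only [Finsupp.single_apply, Finset.sum_ite_eq, Finset.mem_univ, if_true, mul_one]
    positivity

variable {b} in
theorem root'_mem_Ioo_of_mem {x : N} (hx : x ∈ fundamentalAlcove b) {α : ι} (hα : b.IsPos α) :
    P.root' α x ∈ Set.Ioo (0 : ℝ) 1 := by
  obtain ⟨h1, h2⟩ := hx
  obtain ⟨i, hi⟩ := exists_one_le_coeff hα
  constructor
  · rw [root'_eq_sum_coeff b]
    exact Finset.sum_pos' (fun j _ => mul_nonneg (coeff_nonneg hα j) (h1 j).le)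
      ⟨i, Finset.mem_univ _, mul_pos (by linarith) (h1 i)⟩
  · have : P.root' α x ≤ P.root' (highestRoot b) x := by
      rw [root'_eq_sum_coeff b, root'_eq_sum_coeff b (highestRoot b)]
      exact Finset.sum_le_sum fun j _ =>
        mul_le_mul_of_nonneg_right (coeff_le_coeff_highestRoot b α j) (h1 j).le
    linarith

/-- A positive root takes values strictly between `0` and `1` on the alcove, so the sign is decided
by whether `k ≥ 0` or `k ≤ -1`. -/
theorem affEval_sign_aux {α : ι} (hα : b.IsPos α) (k : ℤ) :
    (∀ x ∈ fundamentalAlcove b, 0 < affEval P (α, k) x) ∨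
      ∀ x ∈ fundamentalAlcove b, affEval P (α, k) x < 0 := by
  rcases le_or_gt 0 k with hk | hk
  · left
    intro x hx
    have := (root'_mem_Ioo_of_mem hx hα).1
    have hk' : (0 : ℝ) ≤ k := by exact_mod_cast hk
    simp only [affEval]
    linarith
  · right
    intro x hx
    have := (root'_mem_Ioo_of_mem hx hα).2
    have hk' : (k : ℝ) ≤ -1 := by exact_mod_cast (by omega : k ≤ -1)
    simp only [affEval]
    linarith

theorem affEval_sign (f : ι × ℤ) :
    (∀ x ∈ fundamentalAlcove b, 0 < affEval P f x) ∨
      ∀ x ∈ fundamentalAlcove b, affEval P f x < 0 := by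
  by_cases h : b.IsPos f.1
  · exact affEval_sign_aux b h f.2
  · rcases affEval_sign_aux b ((isPos_reflectionPerm_self_iff b f.1).2 h) (-f.2) with h | h
    · right
      intro x hx
      have := h x hx
      have h2 := affEval_negRoot (P := P) f x
      rw [negRoot] at h2
      linarith
    · left
      intro x hx
      have := h x hx
      have h2 := affEval_negRoot (P := P) f x
      rw [negRoot] at h2
      linarith

variable {b}

theorem affEval_pos_iff {x y : N} (hx : x ∈ fundamentalAlcove b) (hy : y ∈ fundamentalAlcove b)
    (f : ι × ℤ) : 0 < affEval P f x ↔ 0 < affEval P f y := by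
  rcases affEval_sign b f with h | h
  · exact ⟨fun _ => h y hy, fun _ => h x hx⟩
  · exact ⟨fun h' => absurd h' (h x hx).not_gt, fun h' => absurd h' (h y hy).not_gt⟩

theorem affEval_ne_zero {x : N} (hx : x ∈ fundamentalAlcove b) (f : ι × ℤ) :
    affEval P f x ≠ 0 := by
  rcases affEval_sign b f with h | h
  · exact (h x hx).ne'
  · exact (h x hx).ne

theorem affEval_neg_iff {x y : N} (hx : x ∈ fundamentalAlcove b) (hy : y ∈ fundamentalAlcove b)
    (f : ι × ℤ) : affEval P f x < 0 ↔ affEval P f y < 0 := by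
  have h1 := affEval_ne_zero hx f
  have h2 := affEval_ne_zero hy f
  have := affEval_pos_iff hx hy f
  constructor
  · intro h; exact lt_of_le_of_ne (not_lt.1 fun h' => (this.2 h').not_gt h) h2
  · intro h; exact lt_of_le_of_ne (not_lt.1 fun h' => (this.1 h').not_gt h) h1

/-- Vertices lie in the closure of the alcove: if `f` were negative at one, it would vanish on the
open segment towards `x`, inside the alcove. The parameter `t` below is that zero. -/
theorem fundamentalVertex_nonneg {x : N} (hx : x ∈ fundamentalAlcove b) {f : ι × ℤ}
    (h : 0 < affEval P f x) (i : Node b) : 0 ≤ affEval P f (fundamentalVertex b i) := by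
  by_contra! hn
  set v := fundamentalVertex b i
  have hB : 0 < affEval P f x - affEval P f v := by linarith
  let t : ℝ := -affEval P f v / (affEval P f x - affEval P f v)
  have ht0 : 0 < t := div_pos (by linarith) hB
  have ht1 : t < 1 := by rw [div_lt_one hB]; linarith
  have hmem : v + t • (x - v) ∈ fundamentalAlcove b := by
    rw [mem_fundamentalAlcove_iff] at hx ⊢
    intro j
    rw [affEval_lineMap]
    have h0 : 0 ≤ affEval P (wall b j) v := by
      by_cases hij : j = i
      · subst hij
        rw [affEval_wall_fundamentalVertex_self]
        exact (inv_pos.2 (mark_pos b j)).le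
      · rw [affEval_wall_fundamentalVertex_of_ne b hij]
    have := mul_pos ht0 (hx j)
    have := mul_nonneg (by linarith : 0 ≤ 1 - t) h0
    linarith
  have := (affEval_pos_iff hx hmem f).1 h
  rw [affEval_lineMap] at this
  have h3 : (1 - t) * affEval P f v + t * affEval P f x = 0 := by
    simp only [t]
    field_simp
    ring
  linarith

theorem simpleReflection_fundamentalVertex {i j : Node b} (h : i ≠ j) :
    (simpleReflection b i : N ≃ᵃ[ℝ] N) (fundamentalVertex b j) = fundamentalVertex b j := by
  rw [simpleReflection_eq_reflOf, reflOf_apply, affEval_wall_fundamentalVertex_of_ne b h]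
  simp

/-- The only hyperplane that separates the fundamental alcove from its image under a simple
reflection is the corresponding wall. -/
theorem eq_wall_of_separates {f : ι × ℤ} {i : Node b} (h : 0 < affEval P f (basePoint b))
    (h' : affEval P f ((simpleReflection b i : N ≃ᵃ[ℝ] N) (basePoint b)) < 0) :
    f = wall b i := by
  -- Both `f` and `-f ∘ s_i` are positive on the alcove, hence nonnegative at its vertices; `s_i`
  -- fixes the vertices of type other than `i`.
  have hv : ∀ j, j ≠ i → affEval P f (fundamentalVertex b j) = 0 := by
    intro j hj
    refine le_antisymm ?_ (fundamentalVertex_nonneg (basePoint_mem b) h j)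
    have h2 : 0 < affEval P (negRoot P (reflRoot P (wall b i) f)) (basePoint b) := by
      rw [affEval_negRoot, affEval_reflRoot, ← simpleReflection_eq_reflOf]
      linarith
    have h3 := fundamentalVertex_nonneg (basePoint_mem b) h2 j
    rw [affEval_negRoot, affEval_reflRoot, ← simpleReflection_eq_reflOf,
      simpleReflection_fundamentalVertex hj.symm] at h3
    linarith
  obtain ⟨c, hc⟩ : ∃ c : ℝ, ∀ x, affEval P f x = c * affEval P (wall b i) x := by
    refine ⟨affEval P f (fundamentalVertex b i) * mark b i, fun x => ?_⟩
    rw [affEval_eq_sum b f x, Finset.sum_eq_single i (fun j _ hj => by rw [hv j hj, zero_mul])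
      (by simp)]
    ring
  have hcpos : 0 < c := by
    have h1 := (mem_fundamentalAlcove_iff b _).1 (basePoint_mem b) i
    rw [hc] at h
    exact pos_of_mul_pos_left h h1.le
  have h0 := hc 0
  simp only [affEval, map_zero, zero_add] at h0
  have hroot : ∀ x, P.root' f.1 x = c * P.root' (wall b i).1 x := by
    intro x
    have := hc x
    simp only [affEval] at this
    linear_combination this - h0
  have hroot' : P.root f.1 = c • P.root (wall b i).1 := by
    apply P.toPerfPair.injective
    ext x
    simpa using hroot x
  have hdep : ¬ LinearIndependent ℝ ![P.root f.1, P.root (wall b i).1] := by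
    rw [LinearIndependent.pair_iff]
    intro hl
    have := (hl 1 (-c) (by rw [hroot']; module)).1
    exact one_ne_zero this
  have hx0 : ∀ c' : ℝ, c • P.root (wall b i).1 = c' • P.root (wall b i).1 → c = c' :=
    fun c' h => smul_left_injective ℝ (P.ne_zero _) h
  -- Reducedness leaves `c = 1` or `c = -1`, and `c` is positive.
  have hf1 : f.1 = (wall b i).1 ∧ c = 1 := by
    rcases RootPairing.IsReduced.eq_or_eq_neg (P := P) _ _ hdep with he | he
    · exact ⟨P.root.injective he, hx0 1 (by rw [← hroot', he, one_smul])⟩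
    · have := hx0 (-1) (by rw [← hroot', he, neg_smul, one_smul])
      linarith
  refine Prod.ext hf1.1 ?_
  rw [hf1.2, one_mul] at h0
  exact_mod_cast h0

end Alcoves

end AffineBuilding

end

noncomputable section

namespace AffineBuilding

set_option linter.unusedSectionVars false

/-! ### Length, exchange and stabilisers in the affine Weyl group -/

section Length

variable {ι M N : Type*} [AddCommGroup M] [Module ℝ M] [AddCommGroup N] [Module ℝ N]
  {P : RootPairing ι ℝ M N} [P.IsRootSystem] (b : P.Base)
  [Finite ι] [P.IsCrystallographic] [P.IsReduced] [P.IsIrreducible] [Nonempty ι]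

/-- A point on no affine hyperplane. -/
def IsRegularPoint (P : RootPairing ι ℝ M N) (x : N) : Prop := ∀ f, affEval P f x ≠ 0

/-- The affine roots that are positive on the fundamental alcove and negative at `x`. -/
def inversions (x : N) : Set (ι × ℤ) :=
  {f | 0 < affEval P f (basePoint b) ∧ affEval P f x < 0}

theorem finite_inversions (x : N) : (inversions b x).Finite := by
  have : inversions b x ⊆ ⋃ α : ι, (fun k : ℤ => (α, k)) ''
      Set.Icc ⌊-P.root' α (basePoint b)⌋ ⌈-P.root' α x⌉ := by
    rintro ⟨α, k⟩ ⟨h1, h2⟩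
    simp only [affEval] at h1 h2
    refine Set.mem_iUnion.2 ⟨α, k, ⟨?_, ?_⟩, rfl⟩
    · exact Int.floor_le_iff.2 (by linarith)
    · exact Int.le_ceil_iff.2 (by linarith)
  exact (Set.finite_iUnion fun α => (Set.finite_Icc _ _).image _).subset this

variable {b}

theorem wall_basePoint_pos (i : Node b) : 0 < affEval P (wall b i) (basePoint b) :=
  (mem_fundamentalAlcove_iff b _).1 (basePoint_mem b) i

theorem IsRegularPoint.apply {x : N} (hx : IsRegularPoint P x) (w : affineWeylGroup P) :
    IsRegularPoint P ((w : N ≃ᵃ[ℝ] N) x) := by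
  intro f
  obtain ⟨g, hg, -⟩ := exists_pullback w f
  rw [← hg]
  exact hx g

theorem isRegularPoint_of_mem {x : N} (hx : x ∈ fundamentalAlcove b) : IsRegularPoint P x :=
  fun f => affEval_ne_zero hx f

/-- The reflection `s_i` permutes the affine roots positive on the alcove other than the wall `i`,
which is itself an inversion of `x` but not in the image. -/
theorem ncard_inversions_lt {x : N} {i : Node b} (h : affEval P (wall b i) x < 0) :
    (inversions b ((simpleReflection b i : N ≃ᵃ[ℝ] N) x)).ncard < (inversions b x).ncard := by
  have hsub : reflRoot P (wall b i) '' inversions b ((simpleReflection b i : N ≃ᵃ[ℝ] N) x) ⊆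
      inversions b x \ {wall b i} := by
    rintro _ ⟨f, ⟨h1, h2⟩, rfl⟩
    have e : ∀ y, affEval P (reflRoot P (wall b i) f) y =
        affEval P f ((simpleReflection b i : N ≃ᵃ[ℝ] N) y) := fun y => by
      rw [affEval_reflRoot, simpleReflection_eq_reflOf]
    refine ⟨⟨?_, by rw [e]; exact h2⟩, ?_⟩
    · rw [e]
      by_contra hn
      have hne : affEval P f ((simpleReflection b i : N ≃ᵃ[ℝ] N) (basePoint b)) ≠ 0 :=
        (isRegularPoint_of_mem (basePoint_mem b)).apply _ f
      have hf := eq_wall_of_separates h1 (lt_of_le_of_ne (not_lt.1 hn) hne)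
      rw [hf, simpleReflection_eq_reflOf, affEval_reflOf_self] at h2
      linarith
    · intro hf
      have h3 := wall_basePoint_pos i
      rw [← Set.mem_singleton_iff.1 hf, affEval_reflRoot] at h3
      have h4 : affEval P (reflRoot P (wall b i) f) (basePoint b) = - affEval P f (basePoint b) := by
        have h5 := affEval_reflRoot (P := P) (wall b i) f
          ((reflOf P (wall b i) : N ≃ᵃ[ℝ] N) (basePoint b))
        rw [Set.mem_singleton_iff.1 hf, affEval_reflOf_self, ← coe_mul_apply, reflOf_mul_self,
          coe_one_apply] at h5
        rw [Set.mem_singleton_iff.1 hf]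
        linarith
      rw [affEval_reflRoot] at h4
      linarith
  calc _ = (reflRoot P (wall b i) '' inversions b
            ((simpleReflection b i : N ≃ᵃ[ℝ] N) x)).ncard :=
        (Set.ncard_image_of_injective _ (reflRoot_injective _)).symm
    _ ≤ (inversions b x \ {wall b i}).ncard :=
        Set.ncard_le_ncard hsub ((finite_inversions b x).sdiff)
    _ < _ := Set.ncard_sdiff_singleton_lt_of_mem ⟨wall_basePoint_pos i, h⟩ (finite_inversions b x)

variable (b) in
/-- The element spelled by a list of nodes. -/
def listProd (L : List (Node b)) : affineWeylGroup P := (L.map (simpleReflection b)).prod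

theorem listProd_nil : listProd b [] = 1 := rfl

theorem listProd_cons (i : Node b) (L : List (Node b)) :
    listProd b (i :: L) = simpleReflection b i * listProd b L := by
  simp [listProd]

theorem listProd_append (L L' : List (Node b)) :
    listProd b (L ++ L') = listProd b L * listProd b L' := by
  simp [listProd]

theorem listProd_reverse (L : List (Node b)) : listProd b L.reverse = (listProd b L)⁻¹ := by
  induction L with
  | nil => simp [listProd]
  | cons i L ih =>
    rw [List.reverse_cons, listProd_append, ih, listProd_cons, listProd_cons, listProd_nil,
      mul_inv_rev, mul_one, inv_eq_of_mul_eq_one_left (simpleReflection_mul_self b i)]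

/-- Reflecting in a wall that has `x` on its negative side lowers the number of inversions, so the
process ends in the alcove. -/
theorem exists_listProd_mem {x : N} (hx : IsRegularPoint P x) :
    ∃ (L : List (Node b)), ∃ y ∈ fundamentalAlcove b, x = (listProd b L : N ≃ᵃ[ℝ] N) y := by
  induction h : (inversions b x).ncard using Nat.strong_induction_on generalizing x with
  | _ n ih =>
    by_cases hmem : x ∈ fundamentalAlcove b
    · exact ⟨[], x, hmem, rfl⟩
    · rw [mem_fundamentalAlcove_iff] at hmem
      push Not at hmem
      obtain ⟨i, hi⟩ := hmem
      have hlt := ncard_inversions_lt (lt_of_le_of_ne hi (hx _))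
      obtain ⟨L, y, hy, hxy⟩ := ih _ (h ▸ hlt) (hx.apply (simpleReflection b i)) rfl
      refine ⟨i :: L, y, hy, ?_⟩
      rw [listProd_cons, coe_mul_apply, ← hxy, ← coe_mul_apply, simpleReflection_mul_self,
        coe_one_apply]

theorem reflOf_eq_simpleReflection {f : ι × ℤ} {i : Node b}
    (h : affEval P f (basePoint b) *
      affEval P f ((simpleReflection b i : N ≃ᵃ[ℝ] N) (basePoint b)) < 0) :
    reflOf P f = simpleReflection b i := by
  rw [simpleReflection_eq_reflOf]
  rcases mul_neg_iff.1 h with ⟨h1, h2⟩ | ⟨h1, h2⟩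
  · rw [eq_wall_of_separates h1 h2]
  · rw [← reflOf_negRoot f, eq_wall_of_separates (f := negRoot P f) (i := i)
      (by rw [affEval_negRoot]; linarith) (by rw [affEval_negRoot]; linarith)]

/-- The gallery spelled by `L` must cross the hyperplane of `f` somewhere, and reflecting from there
on deletes the letter of the crossing. Either the first step crosses it, or `f` is pulled back
through that step. -/
theorem strong_exchange (L : List (Node b)) (f : ι × ℤ)
    (h : affEval P f (basePoint b) *
      affEval P f ((listProd b L : N ≃ᵃ[ℝ] N) (basePoint b)) < 0) :
    ∃ k < L.length, reflOf P f * listProd b L = listProd b (L.eraseIdx k) := by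
  induction L generalizing f with
  | nil =>
    rw [listProd_nil, coe_one_apply] at h
    exact absurd h (mul_self_nonneg _).not_gt
  | cons i L ih =>
    by_cases hi : affEval P f (basePoint b) *
      affEval P f ((simpleReflection b i : N ≃ᵃ[ℝ] N) (basePoint b)) < 0
    · refine ⟨0, by simp, ?_⟩
      rw [reflOf_eq_simpleReflection hi, listProd_cons, ← mul_assoc, simpleReflection_mul_self,
        one_mul, List.eraseIdx_cons_zero]
    · obtain ⟨g, hg, hg'⟩ := exists_pullback (simpleReflection b i) f
      have hneg : affEval P g (basePoint b) *
          affEval P g ((listProd b L : N ≃ᵃ[ℝ] N) (basePoint b)) < 0 := by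
        rw [hg, hg, ← coe_mul_apply, ← listProd_cons]
        have hne := (isRegularPoint_of_mem (basePoint_mem b)).apply (simpleReflection b i) f
        have hne' := affEval_ne_zero (basePoint_mem b) f
        rcases lt_or_gt_of_ne hne' with h1 | h1
        · have h2 : 0 < affEval P f ((listProd b (i :: L) : N ≃ᵃ[ℝ] N) (basePoint b)) :=
            pos_of_mul_neg_right h h1.le
          refine mul_neg_of_neg_of_pos (lt_of_le_of_ne (not_lt.1 fun h3 => ?_) hne) h2
          exact hi (mul_neg_of_neg_of_pos h1 h3)
        · have h2 : affEval P f ((listProd b (i :: L) : N ≃ᵃ[ℝ] N) (basePoint b)) < 0 :=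
            neg_of_mul_neg_right h h1.le
          refine mul_neg_of_pos_of_neg (lt_of_le_of_ne (not_lt.1 fun h3 => ?_) hne.symm) h2
          exact hi (mul_neg_of_pos_of_neg h1 h3)
      obtain ⟨k, hk, hk'⟩ := ih g hneg
      refine ⟨k + 1, by simpa using hk, ?_⟩
      rw [List.eraseIdx_cons_succ, listProd_cons, listProd_cons, ← hk', hg']
      group

variable (b)

theorem exists_listProd_eq (w : affineWeylGroup P) : ∃ L, listProd b L = w := by
  obtain ⟨w, hw⟩ := w
  induction hw using Subgroup.closure_induction with
  | mem w hw =>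
    obtain ⟨f, rfl⟩ := hw
    change ∃ L, listProd b L = reflOf P f
    -- A word `L` leads to the alcove that contains the reflected base point. The hyperplane
    -- separates it from the fundamental alcove, so exchange writes the reflection as a shortened
    -- `L` times the inverse of `L`.
    obtain ⟨L, y, hy, hL⟩ := exists_listProd_mem (b := b)
      ((isRegularPoint_of_mem (basePoint_mem b)).apply (reflOf P f))
    have hneg : affEval P f (basePoint b) *
        affEval P f ((listProd b L : N ≃ᵃ[ℝ] N) (basePoint b)) < 0 := by
      have h0 := affEval_ne_zero (basePoint_mem b) f
      have h1 := affEval_reflOf_self (P := P) f (basePoint b)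
      rw [hL] at h1
      obtain ⟨g, hg, -⟩ := exists_pullback (listProd b L) f
      rw [← hg] at h1 ⊢
      rcases lt_or_gt_of_ne h0 with h | h
      · exact mul_neg_of_neg_of_pos h
          ((affEval_pos_iff (basePoint_mem b) hy g).2 (by linarith))
      · exact mul_neg_of_pos_of_neg h
          ((affEval_neg_iff (basePoint_mem b) hy g).2 (by linarith))
    obtain ⟨k, -, hk⟩ := strong_exchange L f hneg
    refine ⟨L.eraseIdx k ++ L.reverse, ?_⟩
    rw [listProd_append, listProd_reverse, ← hk]
    group
  | one => exact ⟨[], rfl⟩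
  | mul v w hv hw ihv ihw =>
    obtain ⟨L, hL⟩ := ihv
    obtain ⟨L', hL'⟩ := ihw
    exact ⟨L ++ L', by rw [listProd_append, hL, hL']; rfl⟩
  | inv v hv ihv =>
    obtain ⟨L, hL⟩ := ihv
    exact ⟨L.reverse, by rw [listProd_reverse, hL]; rfl⟩

/-- The length of an element of the affine Weyl group. -/
def length (w : affineWeylGroup P) : ℕ := sInf {n | ∃ L, listProd b L = w ∧ L.length = n}

theorem exists_reduced (w : affineWeylGroup P) :
    ∃ L, listProd b L = w ∧ L.length = length b w :=
  Nat.sInf_mem (s := {n | ∃ L, listProd b L = w ∧ L.length = n})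
    ((exists_listProd_eq b w).elim fun L hL => ⟨_, L, hL, rfl⟩)

variable {b}

theorem length_listProd_le (L : List (Node b)) : length b (listProd b L) ≤ L.length :=
  Nat.sInf_le ⟨L, rfl, rfl⟩

theorem length_one : length b (1 : affineWeylGroup P) = 0 :=
  Nat.le_zero.1 (length_listProd_le [])

theorem length_inv (w : affineWeylGroup P) : length b w⁻¹ = length b w := by
  have h : ∀ w : affineWeylGroup P, length b w⁻¹ ≤ length b w := by
    intro w
    obtain ⟨L, rfl, hl⟩ := exists_reduced b w
    rw [← hl, ← listProd_reverse, ← L.length_reverse]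
    exact length_listProd_le _
  refine le_antisymm (h w) ?_
  simpa using h w⁻¹

theorem length_simple_mul_le (i : Node b) (w : affineWeylGroup P) :
    length b (simpleReflection b i * w) ≤ length b w + 1 := by
  obtain ⟨L, rfl, hl⟩ := exists_reduced b w
  rw [← hl, ← listProd_cons]
  exact length_listProd_le _

theorem exists_left_descent {w : affineWeylGroup P} (h : w ≠ 1) :
    ∃ i, length b (simpleReflection b i * w) < length b w := by
  obtain ⟨L, rfl, hl⟩ := exists_reduced b w
  cases L with
  | nil => exact absurd rfl h
  | cons i L =>
    refine ⟨i, ?_⟩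
    rw [← hl, listProd_cons, ← mul_assoc, simpleReflection_mul_self, one_mul, List.length_cons]
    exact Nat.lt_succ_of_le (length_listProd_le L)

theorem length_reflOf_mul_lt {f : ι × ℤ} {w : affineWeylGroup P}
    (h : affEval P f (basePoint b) * affEval P f ((w : N ≃ᵃ[ℝ] N) (basePoint b)) < 0) :
    length b (reflOf P f * w) < length b w := by
  obtain ⟨L, rfl, hl⟩ := exists_reduced b w
  obtain ⟨k, hk, he⟩ := strong_exchange L f h
  rw [he, ← hl]
  refine lt_of_le_of_lt (length_listProd_le _) ?_
  rw [List.length_eraseIdx_of_lt hk]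
  omega

theorem regular_apply_basePoint (w : affineWeylGroup P) (f : ι × ℤ) :
    affEval P f ((w : N ≃ᵃ[ℝ] N) (basePoint b)) ≠ 0 :=
  (isRegularPoint_of_mem (basePoint_mem b)).apply w f

theorem length_lt_reflOf_mul {f : ι × ℤ} {w : affineWeylGroup P}
    (h : 0 < affEval P f (basePoint b) * affEval P f ((w : N ≃ᵃ[ℝ] N) (basePoint b))) :
    length b w < length b (reflOf P f * w) := by
  have : length b (reflOf P f * (reflOf P f * w)) < length b (reflOf P f * w) := by
    apply length_reflOf_mul_lt
    rw [coe_mul_apply, affEval_reflOf_self]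
    linarith
  rwa [← mul_assoc, reflOf_mul_self, one_mul] at this

theorem length_reflOf_mul_lt_iff {f : ι × ℤ} {w : affineWeylGroup P} :
    length b (reflOf P f * w) < length b w ↔
      affEval P f (basePoint b) * affEval P f ((w : N ≃ᵃ[ℝ] N) (basePoint b)) < 0 := by
  refine ⟨fun h => ?_, length_reflOf_mul_lt⟩
  by_contra hn
  refine absurd (length_lt_reflOf_mul (lt_of_le_of_ne (not_lt.1 hn) ?_)) h.not_gt
  exact (mul_ne_zero (affEval_ne_zero (basePoint_mem b) f) (regular_apply_basePoint w f)).symm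

/-- The dictionary between word length and geometry: `s_i` is a left descent exactly when the alcove
of `w` is beyond the wall `i`. -/
theorem length_simple_mul_lt_iff {i : Node b} {w : affineWeylGroup P} :
    length b (simpleReflection b i * w) < length b w ↔
      affEval P (wall b i) ((w : N ≃ᵃ[ℝ] N) (basePoint b)) < 0 := by
  rw [simpleReflection_eq_reflOf, length_reflOf_mul_lt_iff]
  exact ⟨fun h => neg_of_mul_neg_right h (wall_basePoint_pos i).le,
    fun h => mul_neg_of_pos_of_neg (wall_basePoint_pos i) h⟩

theorem length_lt_simple_mul_iff {i : Node b} {w : affineWeylGroup P} :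
    length b w < length b (simpleReflection b i * w) ↔
      0 < affEval P (wall b i) ((w : N ≃ᵃ[ℝ] N) (basePoint b)) := by
  constructor
  · intro h
    by_contra hn
    exact absurd (length_simple_mul_lt_iff.2
      (lt_of_le_of_ne (not_lt.1 hn) (regular_apply_basePoint w _))) h.not_gt
  · intro h
    rw [simpleReflection_eq_reflOf]
    exact length_lt_reflOf_mul (mul_pos (wall_basePoint_pos i) h)

theorem length_simple_mul_ne (i : Node b) (w : affineWeylGroup P) :
    length b (simpleReflection b i * w) ≠ length b w := by
  rcases lt_or_gt_of_ne (regular_apply_basePoint (b := b) w (wall b i)) with h | h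
  · exact (length_simple_mul_lt_iff.2 h).ne
  · exact (length_lt_simple_mul_iff.2 h).ne'

/-- The folding condition: a wall that separates two adjacent alcoves contains their common
panel. -/
theorem simple_mul_eq_mul_simple {i j : Node b} {w : affineWeylGroup P}
    (h : length b w < length b (simpleReflection b i * w))
    (h' : length b (simpleReflection b i * (w * simpleReflection b j)) <
      length b (w * simpleReflection b j)) :
    simpleReflection b i * w = w * simpleReflection b j := by
  rw [length_lt_simple_mul_iff] at h
  rw [length_simple_mul_lt_iff] at h'
  obtain ⟨g, hg, hg'⟩ := exists_pullback w (wall b i)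
  rw [coe_mul_apply, ← hg] at h'
  rw [← hg] at h
  have := reflOf_eq_simpleReflection (mul_neg_of_pos_of_neg h h')
  rw [← this, hg', ← simpleReflection_eq_reflOf]
  group

/-- A wall that separates two alcoves is crossed by any minimal gallery between them. -/
theorem length_conj_lt {i : Node b} {v u : affineWeylGroup P}
    (h : length b (simpleReflection b i * v) < length b v)
    (h' : length b (v * u) < length b (simpleReflection b i * (v * u))) :
    length b (v⁻¹ * simpleReflection b i * v * u) < length b u := by
  rw [length_simple_mul_lt_iff] at h
  rw [length_lt_simple_mul_iff] at h'
  obtain ⟨g, hg, hg'⟩ := exists_pullback v (wall b i)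
  rw [coe_mul_apply, ← hg] at h'
  rw [← hg] at h
  rw [simpleReflection_eq_reflOf, ← hg']
  exact length_reflOf_mul_lt (mul_neg_of_neg_of_pos h h')

/-- A point of the closed fundamental alcove is only mapped to the closed fundamental alcove by
elements of its stabiliser. -/
theorem apply_fundamentalVertex_eq {w : affineWeylGroup P} {i j : Node b}
    (h : (w : N ≃ᵃ[ℝ] N) (fundamentalVertex b i) = fundamentalVertex b j) :
    fundamentalVertex b i = fundamentalVertex b j := by
  induction hn : length b w using Nat.strong_induction_on generalizing w with
  | _ n ih =>
    by_cases hw : w = 1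
    · rw [hw, coe_one_apply] at h; exact h
    · obtain ⟨k, hk⟩ := exists_left_descent (b := b) hw
      have hneg := length_simple_mul_lt_iff.1 hk
      -- The alcove of `w` is beyond the wall `k`, so its closure meets the closed fundamental
      -- alcove only in that wall. The common vertex is therefore fixed by `s_k`, and `s_k w` is
      -- shorter.
      obtain ⟨g, hg, -⟩ := exists_pullback w (negRoot P (wall b k))
      have h1 : 0 ≤ affEval P g (fundamentalVertex b i) := by
        refine fundamentalVertex_nonneg (basePoint_mem b) ?_ i
        rw [hg, affEval_negRoot]
        linarith
      rw [hg, h, affEval_negRoot] at h1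
      have h2 := fundamentalVertex_nonneg (basePoint_mem b) (wall_basePoint_pos k) j
      refine ih _ (hn ▸ hk) (w := simpleReflection b k * w) ?_ rfl
      rw [coe_mul_apply, h, simpleReflection_eq_reflOf, reflOf_apply,
        le_antisymm (by linarith) h2]
      simp

/-- The vertex of type `k` is strictly inside the wall `k`, so it cannot belong to an alcove beyond
that wall. -/
theorem simple_of_descent_of_fixes {w : affineWeylGroup P} {k j : Node b}
    (hk : length b (simpleReflection b k * w) < length b w)
    (h : (w : N ≃ᵃ[ℝ] N) (fundamentalVertex b j) = fundamentalVertex b j) : k ≠ j := by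
  rintro rfl
  have hneg := length_simple_mul_lt_iff.1 hk
  obtain ⟨g, hg, -⟩ := exists_pullback w (negRoot P (wall b k))
  have h1 : 0 ≤ affEval P g (fundamentalVertex b k) := by
    refine fundamentalVertex_nonneg (basePoint_mem b) ?_ k
    rw [hg, affEval_negRoot]
    linarith
  rw [hg, h, affEval_negRoot, affEval_wall_fundamentalVertex_self] at h1
  have := inv_pos.2 (mark_pos b k)
  linarith

variable (b) in
theorem fundamentalVertex_injective : Function.Injective (fundamentalVertex b) := by
  intro i j h
  by_contra hne
  have h1 := affEval_wall_fundamentalVertex_self b i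
  rw [h, affEval_wall_fundamentalVertex_of_ne b hne] at h1
  exact (inv_pos.2 (mark_pos b i)).ne h1

/-- The affine Weyl group preserves types. -/
theorem type_eq {v w : affineWeylGroup P} {i j : Node b}
    (h : (v : N ≃ᵃ[ℝ] N) (fundamentalVertex b i) = (w : N ≃ᵃ[ℝ] N) (fundamentalVertex b j)) :
    i = j := by
  refine fundamentalVertex_injective b (apply_fundamentalVertex_eq (w := w⁻¹ * v) ?_)
  rw [coe_mul_apply, h, coe_inv_apply_self]

/-- The stabiliser of a vertex is generated by simple reflections. -/
theorem stabilizer_induction {p : affineWeylGroup P → Prop} {S : Set (Node b)}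
    (one : p 1) (mul : ∀ k ∉ S, ∀ w, p w → p (simpleReflection b k * w))
    {w : affineWeylGroup P}
    (h : ∀ j ∈ S, (w : N ≃ᵃ[ℝ] N) (fundamentalVertex b j) = fundamentalVertex b j) : p w := by
  induction hn : length b w using Nat.strong_induction_on generalizing w with
  | _ n ih =>
    by_cases hw : w = 1
    · rw [hw]; exact one
    · obtain ⟨k, hk⟩ := exists_left_descent (b := b) hw
      have hkS : k ∉ S := fun hkS => simple_of_descent_of_fixes hk (h k hkS) rfl
      have := mul k hkS _ (ih _ (hn ▸ hk) (w := simpleReflection b k * w) (fun j hj => by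
        rw [coe_mul_apply, h j hj, simpleReflection_fundamentalVertex]
        rintro rfl
        exact hkS hj) rfl)
      rwa [← mul_assoc, simpleReflection_mul_self, one_mul] at this

theorem eq_one_or_eq_simple {w : affineWeylGroup P} {i : Node b}
    (h : ∀ j, j ≠ i → (w : N ≃ᵃ[ℝ] N) (fundamentalVertex b j) = fundamentalVertex b j) :
    w = 1 ∨ w = simpleReflection b i := by
  refine stabilizer_induction (b := b) (p := fun w => w = 1 ∨ w = simpleReflection b i) (S := {i}ᶜ) (Or.inl rfl) (fun k hk w hw => ?_) h
  simp only [Set.mem_compl_iff, Set.mem_singleton_iff, not_not] at hk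
  subst hk
  rcases hw with rfl | rfl
  · right; rw [mul_one]
  · left; exact simpleReflection_mul_self b k

theorem simpleReflection_ne_one (i : Node b) : simpleReflection b i ≠ 1 := by
  intro h
  have := length_simple_mul_ne (b := b) i 1
  rw [h, mul_one] at this
  exact this rfl

end Length

end AffineBuilding

end

noncomputable section

namespace AffineBuilding

set_option linter.unusedSectionVars false

/-! ### Weyl distances and extension of isometries -/

section WeylDistance

variable {ι M N : Type*} [AddCommGroup M] [Module ℝ M] [AddCommGroup N] [Module ℝ N]
  {P : RootPairing ι ℝ M N} [P.IsRootSystem] {b : P.Base}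
  [Finite ι] [P.IsCrystallographic] [P.IsReduced] [P.IsIrreducible] [Nonempty ι]
  {C : Type*}

theorem simple_inv (i : Node b) : (simpleReflection b i)⁻¹ = simpleReflection b i :=
  inv_eq_of_mul_eq_one_left (simpleReflection_mul_self b i)

theorem mul_simple_mul_simple (w : affineWeylGroup P) (i : Node b) :
    w * simpleReflection b i * simpleReflection b i = w := by
  rw [mul_assoc, simpleReflection_mul_self, mul_one]

theorem simple_mul_simple_mul (w : affineWeylGroup P) (i : Node b) :
    simpleReflection b i * (simpleReflection b i * w) = w := by
  rw [← mul_assoc, simpleReflection_mul_self, one_mul]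

theorem length_mul_simple (w : affineWeylGroup P) (i : Node b) :
    length b (w * simpleReflection b i) = length b (simpleReflection b i * w⁻¹) := by
  rw [← length_inv, mul_inv_rev, simple_inv]

theorem length_mul_simple_le (w : affineWeylGroup P) (i : Node b) :
    length b (w * simpleReflection b i) ≤ length b w + 1 := by
  rw [length_mul_simple, ← length_inv w]
  exact length_simple_mul_le _ _

theorem exists_right_descent {w : affineWeylGroup P} (h : w ≠ 1) :
    ∃ i, length b (w * simpleReflection b i) < length b w := by
  obtain ⟨i, hi⟩ := exists_left_descent (b := b) (w := w⁻¹) (by simpa using h)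
  exact ⟨i, by rwa [length_mul_simple, ← length_inv w]⟩

theorem weyl_induction {p : affineWeylGroup P → Prop} (one : p 1)
    (mul : ∀ w (i : Node b), p w → p (w * simpleReflection b i)) (w : affineWeylGroup P) : p w := by
  induction hn : length b w using Nat.strong_induction_on generalizing w with
  | _ n ih =>
    by_cases hw : w = 1
    · rw [hw]; exact one
    · obtain ⟨i, hi⟩ := exists_right_descent (b := b) hw
      have := mul _ i (ih _ (hn ▸ hi) _ rfl)
      rwa [mul_simple_mul_simple] at this

variable (b) in
/-- The axioms of a distance function with values in the affine Weyl group. -/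
structure IsWeylDistance (δ : C → C → affineWeylGroup P) : Prop where
  eq_one_iff : ∀ c d, δ c d = 1 ↔ c = d
  inv : ∀ c d, (δ c d)⁻¹ = δ d c
  step : ∀ {c d d' i}, δ d d' = simpleReflection b i →
    δ c d' = δ c d * simpleReflection b i ∨ δ c d' = δ c d
  exists_step : ∀ c d i, ∃ d', δ d d' = simpleReflection b i ∧
    δ c d' = δ c d * simpleReflection b i

/-- Partial isometries from the affine Weyl group, given by their graphs. -/
def IsIsometricGraph (δ : C → C → affineWeylGroup P) (G : Set (affineWeylGroup P × C)) : Prop :=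
  ∀ p ∈ G, ∀ q ∈ G, δ p.2 q.2 = p.1⁻¹ * q.1

/-- Isometries from the affine Weyl group. -/
def IsIsometry (δ : C → C → affineWeylGroup P) (φ : affineWeylGroup P → C) : Prop :=
  ∀ v w, δ (φ v) (φ w) = v⁻¹ * w

namespace IsWeylDistance

variable {δ : C → C → affineWeylGroup P} (h : IsWeylDistance b δ)

include h

theorem self (c : C) : δ c c = 1 := (h.eq_one_iff c c).2 rfl

theorem symm_simple {c d : C} {i : Node b} (hcd : δ c d = simpleReflection b i) :
    δ d c = simpleReflection b i := by
  rw [← h.inv, hcd, simple_inv]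

theorem step_left {c d e : C} {i : Node b} (hcd : δ c d = simpleReflection b i) :
    δ d e = simpleReflection b i * δ c e ∨ δ d e = δ c e := by
  rcases h.step (c := e) hcd with h1 | h1
  · left; rw [← h.inv, h1, mul_inv_rev, simple_inv, h.inv]
  · right; rw [← h.inv, h1, h.inv]

/-- `step` allows two values, and induction on the distance excludes the shorter one. Moving `c` one
step `t` closer to `d`, the value `w` for `δ c d'` would force `ws = w`, or `tw = ws` with `ws`
shorter than `w`. -/
theorem dist_of_length_lt {c d d' : C} {i : Node b} (hd : δ d d' = simpleReflection b i)
    (hl : length b (δ c d) < length b (δ c d * simpleReflection b i)) :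
    δ c d' = δ c d * simpleReflection b i := by
  induction hn : length b (δ c d) using Nat.strong_induction_on generalizing c with
  | _ n ih =>
    by_cases hw : δ c d = 1
    · rw [hw, (h.eq_one_iff c d).1 hw, hd, one_mul]
    · obtain ⟨t, ht⟩ := exists_left_descent (b := b) hw
      obtain ⟨c', hc', hdc'⟩ := h.exists_step d c t
      have hu : δ c' d = simpleReflection b t * δ c d := by
        rw [← h.inv, hdc', mul_inv_rev, simple_inv, h.inv]
      have hlu : length b (δ c' d) < length b (δ c' d * simpleReflection b i) := by
        have h1 := length_simple_mul_le t (δ c' d * simpleReflection b i)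
        rw [hu, mul_assoc, simple_mul_simple_mul] at h1
        rw [hu, mul_assoc]
        omega
      have h2 := ih _ (by rw [hu, ← hn]; exact ht) hlu rfl
      rcases h.step (c := c) hd with h3 | h3
      · exact h3
      · exfalso
        rcases h.step_left (e := d') (h.symm_simple hc') with h4 | h4
        · rw [h4, h2, hu, mul_assoc, simple_mul_simple_mul] at h3
          rw [h3] at hl
          exact lt_irrefl _ hl
        · rw [h4, h2, hu] at h3
          have h5 := congrArg (· * simpleReflection b i) h3
          simp only [mul_simple_mul_simple] at h5
          rw [← h5] at hl
          omega

/-- The retraction `e ↦ δ c e` centred at `c` does not increase distances. -/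
theorem length_inv_mul_dist_le (c d e : C) :
    length b ((δ c d)⁻¹ * δ c e) ≤ length b (δ d e) := by
  induction hn : length b (δ d e) using Nat.strong_induction_on generalizing e with
  | _ n ih =>
    by_cases hw : δ d e = 1
    · rw [(h.eq_one_iff d e).1 hw, inv_mul_cancel, length_one]
      exact Nat.zero_le _
    · obtain ⟨t, ht⟩ := exists_right_descent (b := b) hw
      obtain ⟨e', he', hde'⟩ := h.exists_step d e t
      have h1 := ih _ (by rw [hde', ← hn]; exact ht) e' rfl
      rw [hde'] at h1
      rcases h.step (c := c) (h.symm_simple he') with h2 | h2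
      · have h3 := length_mul_simple_le ((δ c d)⁻¹ * δ c e') t
        rw [h2, ← mul_assoc]
        omega
      · rw [h2]
        omega

/-- Chambers on the far side of a wall have the same projection to a panel in that wall. -/
theorem dist_of_same_projection {c d e₀ e : C} {i : Node b} (hcd : δ c d = simpleReflection b i)
    (h₀ : length b (simpleReflection b i * δ c e₀) < length b (δ c e₀))
    (hd₀ : δ d e₀ = simpleReflection b i * δ c e₀)
    (he : length b (simpleReflection b i * δ c e) < length b (δ c e))
    (hee : δ c e = δ c e₀ * δ e₀ e) : δ d e = simpleReflection b i * δ c e := by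
  induction hn : length b (δ e₀ e) using Nat.strong_induction_on generalizing e with
  | _ n ih =>
    by_cases hw : δ e₀ e = 1
    · rw [← (h.eq_one_iff e₀ e).1 hw, hd₀]
    · obtain ⟨t, ht⟩ := exists_right_descent (b := b) hw
      -- The induction runs along a minimal gallery from `e₀` to `e`, of which `e'` is the
      -- penultimate chamber.
      obtain ⟨e', he', hde'⟩ := h.exists_step e₀ e t
      have hce' : δ c e' = δ c e * simpleReflection b t := by
        rcases h.step (c := c) he' with h1 | h1
        · exact h1
        · exfalso
          have h2 := h.length_inv_mul_dist_le c e₀ e'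
          rw [h1, hee, inv_mul_cancel_left, hde'] at h2
          omega
      have hce'' : δ c e' = δ c e₀ * δ e₀ e' := by rw [hce', hde', hee, mul_assoc]
      -- If `e'` were on the near side, the wall would be crossed between `e'` and `e`, and
      -- reflecting `e'` to `e` would bring it closer to `e₀`, against minimality.
      have hdesc : length b (simpleReflection b i * δ c e') < length b (δ c e') := by
        refine lt_of_le_of_ne (not_lt.1 fun h1 => ?_) (length_simple_mul_ne i _)
        have hfold := simple_mul_eq_mul_simple (j := t) h1
          (by rwa [hce', mul_simple_mul_simple])
        have h2 := length_conj_lt (b := b) (i := i) (v := δ c e₀) (u := δ e₀ e') h₀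
          (by rwa [← hce''])
        rw [mul_assoc, mul_assoc, ← hce'', hfold, hce', mul_simple_mul_simple, hee,
          inv_mul_cancel_left, hde'] at h2
        omega
      have h1 := ih _ (by rw [hde', ← hn]; exact ht) hdesc hce'' rfl
      rw [hce'] at h1 hdesc
      rcases h.step (c := d) (h.symm_simple he') with h2 | h2
      · rw [h2, h1, ← mul_assoc, mul_simple_mul_simple]
      · exfalso
        rw [h1] at h2
        rcases h.step_left (e := e) (h.symm_simple hcd) with h3 | h3
        · rw [h2, simple_mul_simple_mul] at h3
          have := congrArg ((δ c e)⁻¹ * ·) h3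
          simp only [inv_mul_cancel, inv_mul_cancel_left] at this
          exact simpleReflection_ne_one t this.symm
        · rw [h2] at h3
          rw [h3, simple_mul_simple_mul, ← h3] at he
          have h4 : simpleReflection b i * δ c e = δ c e * simpleReflection b t := by
            conv_lhs => rw [h3, simple_mul_simple_mul]
          rw [← h4, simple_mul_simple_mul] at hdesc
          rw [← h4] at he
          omega

/-- The new chamber `d` must be one step further from the chambers on the near side of the wall, and
one step closer to those on the far side. Every neighbour does the former; if the far side is
occupied, `d` is the projection of one such chamber to the panel, which serves all of them. -/
theorem exists_extend {G : Set (affineWeylGroup P × C)} (hG : IsIsometricGraph δ G)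
    {x : affineWeylGroup P} {c : C} (hxc : (x, c) ∈ G) (i : Node b) :
    ∃ d, IsIsometricGraph δ (insert (x * simpleReflection b i, d) G) := by
  suffices ∃ d, ∀ p ∈ G, δ d p.2 = simpleReflection b i * δ c p.2 by
    obtain ⟨d, hd⟩ := this
    have hd' : ∀ p ∈ G, δ d p.2 = (x * simpleReflection b i)⁻¹ * p.1 := fun p hp => by
      rw [hd p hp, hG _ hxc _ hp, mul_inv_rev, simple_inv, mul_assoc]
    refine ⟨d, ?_⟩
    rintro p (rfl | hp) q (rfl | hq)
    · rw [h.self, inv_mul_cancel]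
    · exact hd' q hq
    · rw [← h.inv, hd' p hp]; group
    · exact hG p hp q hq
  have hasc : ∀ d, δ c d = simpleReflection b i → ∀ e,
      length b (δ c e) < length b (simpleReflection b i * δ c e) →
      δ d e = simpleReflection b i * δ c e := by
    intro d hd e he
    have := h.dist_of_length_lt (c := e) hd (by
      rwa [length_mul_simple, h.inv, ← h.inv c, length_inv])
    rw [← h.inv, this, mul_inv_rev, simple_inv, h.inv]
  by_cases hex : ∃ p ∈ G, length b (simpleReflection b i * δ c p.2) < length b (δ c p.2)
  · obtain ⟨p, hp, hlt⟩ := hex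
    obtain ⟨d, hcd, hpd⟩ := h.exists_step p.2 c i
    have hdp : δ d p.2 = simpleReflection b i * δ c p.2 := by
      rw [← h.inv, hpd, mul_inv_rev, simple_inv, h.inv]
    refine ⟨d, fun q hq => ?_⟩
    rcases lt_or_gt_of_ne (length_simple_mul_ne i (δ c q.2)) with hl | hl
    · refine h.dist_of_same_projection hcd hlt hdp hl ?_
      rw [hG _ hxc _ hq, hG _ hxc _ hp, hG _ hp _ hq]
      group
    · exact hasc d hcd _ hl
  · obtain ⟨d, hcd, -⟩ := h.exists_step c c i
    refine ⟨d, fun q hq => hasc d hcd _ ?_⟩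
    exact lt_of_le_of_ne (not_lt.1 fun hl => hex ⟨q, hq, hl⟩) (length_simple_mul_ne i _).symm

/-- A partial isometry extends to the whole affine Weyl group. -/
theorem exists_isometry {G : Set (affineWeylGroup P × C)} (hG : IsIsometricGraph δ G)
    (hne : G.Nonempty) : ∃ φ, IsIsometry δ φ ∧ ∀ p ∈ G, φ p.1 = p.2 := by
  obtain ⟨H, hGH, hH⟩ := zorn_subset_nonempty {H | IsIsometricGraph δ H}
    (fun c hc hchain _ => ⟨⋃₀ c, fun p hp q hq => by
      obtain ⟨s, hs, hps⟩ := hp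
      obtain ⟨t, ht, hqt⟩ := hq
      rcases hchain.total hs ht with hst | hts
      · exact hc ht p (hst hps) q hqt
      · exact hc hs p hps q (hts hqt), fun s hs => Set.subset_sUnion_of_mem hs⟩) G hG
  have hiso : IsIsometricGraph δ H := hH.prop
  have hall : ∀ w : affineWeylGroup P, ∃ c, (w, c) ∈ H := by
    obtain ⟨⟨x, c⟩, hp⟩ := hne
    -- By maximality the domain is closed under right multiplication by simple reflections.
    have key : ∀ w : affineWeylGroup P, ∃ c, (x * w, c) ∈ H := by
      refine weyl_induction (b := b) ⟨c, by rw [mul_one]; exact hGH hp⟩ ?_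
      rintro w i ⟨c, hc⟩
      obtain ⟨d, hd⟩ := h.exists_extend hiso hc i
      refine ⟨d, ?_⟩
      rw [← mul_assoc]
      exact hH.le_of_ge hd (Set.subset_insert _ _) (Set.mem_insert _ _)
    intro w
    simpa using key (x⁻¹ * w)
  choose φ hφ using hall
  refine ⟨φ, fun v w => hiso _ (hφ v) _ (hφ w), fun p hp => ?_⟩
  have := hiso _ (hφ p.1) _ (hGH hp)
  rw [inv_mul_cancel] at this
  exact (h.eq_one_iff _ _).1 this

end IsWeylDistance

/-! ### Retraction along a filter -/

/-- `y` lies on the same side as `x` of the wall that separates `x` from `x s_i`. -/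
def SameSide (i : Node b) (x y : affineWeylGroup P) : Prop :=
  length b (x⁻¹ * y) < length b (simpleReflection b i * (x⁻¹ * y))

theorem sameSide_mul_simple_iff {i : Node b} {x y : affineWeylGroup P} :
    SameSide i (x * simpleReflection b i) y ↔ ¬ SameSide i x y := by
  have := length_simple_mul_ne (b := b) i (x⁻¹ * y)
  rw [SameSide, SameSide, mul_inv_rev, simple_inv, mul_assoc, simple_mul_simple_mul]
  omega

/-- `w` is the retraction of the chamber `c` onto the image of `base` along the filter `F`. -/
def RetractsAlong (δ : C → C → affineWeylGroup P) (F : Filter (affineWeylGroup P))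
    (base : affineWeylGroup P → C) (c : C) (w : affineWeylGroup P) : Prop :=
  ∃ φ, IsIsometry δ φ ∧ φ w = c ∧ ∀ᶠ y in F, φ y = base y

variable {δ : C → C → affineWeylGroup P} {F : Filter (affineWeylGroup P)}
  {base : affineWeylGroup P → C} {c : C}

theorem RetractsAlong.unique [F.NeBot] {v w : affineWeylGroup P}
    (hv : RetractsAlong δ F base c v) (hw : RetractsAlong δ F base c w) : v = w := by
  obtain ⟨φ, hφ, rfl, hφb⟩ := hv
  obtain ⟨ψ, hψ, hψw, hψb⟩ := hw
  obtain ⟨y, hy, hy'⟩ := (hφb.and hψb).exists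
  have h1 := hφ y v
  rw [hy, ← hψw, ← hy', hψ] at h1
  exact (mul_left_cancel h1).symm

/-- The half-apartment on the side of `x` together with `d` is a partial isometry; its extension
still agrees with `base` eventually. -/
theorem RetractsAlong.of_sameSide (h : IsWeylDistance b δ) {x : affineWeylGroup P} {d : C}
    {i : Node b} (hx : RetractsAlong δ F base c x) (hs : ∀ᶠ y in F, SameSide i x y)
    (hcd : δ c d = simpleReflection b i) :
    RetractsAlong δ F base d (x * simpleReflection b i) := by
  obtain ⟨φ, hφ, rfl, hφb⟩ := hx
  have hd : ∀ y, SameSide i x y → δ d (φ y) = (x * simpleReflection b i)⁻¹ * y := by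
    intro y hy
    have := h.dist_of_length_lt (c := φ y) hcd (by
      rw [hφ, length_mul_simple, mul_inv_rev, inv_inv, ← length_inv, mul_inv_rev, inv_inv]
      exact hy)
    rw [← h.inv, this, hφ]
    simp only [mul_inv_rev, inv_inv]
    rw [mul_assoc]
  have hG : IsIsometricGraph δ
      (insert (x * simpleReflection b i, d) ((fun y => (y, φ y)) '' {y | SameSide i x y})) := by
    rintro p (rfl | ⟨y, hy, rfl⟩) q (rfl | ⟨z, hz, rfl⟩)
    · rw [h.self, inv_mul_cancel]
    · exact hd z hz
    · rw [← h.inv, hd y hy]; group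
    · exact hφ y z
  obtain ⟨ψ, hψ, hψG⟩ := h.exists_isometry hG ⟨_, Set.mem_insert _ _⟩
  refine ⟨ψ, hψ, hψG _ (Set.mem_insert _ _), ?_⟩
  filter_upwards [hs, hφb] with y hy hyb
  rw [← hyb]
  exact hψG _ (Set.mem_insert_of_mem _ ⟨y, hy, rfl⟩)

/-- The apartment itself contains the neighbour `c'` at `x s_i`. From `c'` the filter is on the same
side, so `RetractsAlong.of_sameSide` sends all its other neighbours to `x`. -/
theorem RetractsAlong.exists_of_not_sameSide (h : IsWeylDistance b δ) {x : affineWeylGroup P}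
    {i : Node b} (hx : RetractsAlong δ F base c x) (hs : ∀ᶠ y in F, ¬ SameSide i x y) :
    ∃ c', δ c c' = simpleReflection b i ∧
      RetractsAlong δ F base c' (x * simpleReflection b i) ∧
      ∀ d, δ c d = simpleReflection b i → d ≠ c' → RetractsAlong δ F base d x := by
  obtain ⟨φ, hφ, rfl, hφb⟩ := id hx
  refine ⟨φ (x * simpleReflection b i), by rw [hφ, inv_mul_cancel_left],
    ⟨φ, hφ, rfl, hφb⟩, fun d hd hne => ?_⟩
  have h1 : δ (φ (x * simpleReflection b i)) d = simpleReflection b i := by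
    have h2 : δ (φ (x * simpleReflection b i)) (φ x) = simpleReflection b i := by
      rw [hφ, mul_inv_rev, simple_inv, inv_mul_cancel_right]
    rcases h.step_left (e := d) (h.symm_simple h2) with h3 | h3
    · rw [hd, simpleReflection_mul_self, h.eq_one_iff] at h3
      exact absurd h3.symm hne
    · rw [h3, hd]
  have h2 := RetractsAlong.of_sameSide (F := F) (base := base) (i := i) (d := d) h
    (x := x * simpleReflection b i) ⟨φ, hφ, rfl, hφb⟩
    (hs.mono fun y hy => sameSide_mul_simple_iff.2 hy) h1
  rwa [mul_simple_mul_simple] at h2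

/-- Induction on a gallery from `base 1` to `c`; each step falls under one of the two preceding
cases. -/
theorem exists_retractsAlong (h : IsWeylDistance b δ) (hbase : IsIsometry δ base)
    (hF : ∀ (x : affineWeylGroup P) (i : Node b),
      (∀ᶠ y in F, SameSide i x y) ∨ ∀ᶠ y in F, ¬ SameSide i x y) (c : C) :
    ∃ x, RetractsAlong δ F base c x := by
  suffices key : ∀ w c, δ (base 1) c = w → ∃ x, RetractsAlong δ F base c x from key _ c rfl
  refine weyl_induction (b := b) ?_ ?_
  · intro c hc
    exact ⟨1, base, hbase, (h.eq_one_iff _ _).1 hc, Filter.Eventually.of_forall fun _ => rfl⟩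
  · intro w i ih c hc
    obtain ⟨c', hcc', hc'⟩ := h.exists_step (base 1) c i
    rw [hc, mul_simple_mul_simple] at hc'
    obtain ⟨x, hx⟩ := ih c' hc'
    have hcc := h.symm_simple hcc'
    rcases hF x i with hs | hs
    · exact ⟨_, hx.of_sameSide h hs hcc⟩
    · obtain ⟨c'', -, h2, h3⟩ := hx.exists_of_not_sameSide h hs
      by_cases he : c = c''
      · exact ⟨_, he ▸ h2⟩
      · exact ⟨_, h3 c hcc he⟩

end WeylDistance

end AffineBuilding

end

noncomputable section

namespace AffineBuilding

set_option linter.unusedSectionVars false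

/-! ### Charts of apartments by the Coxeter complex -/

section SimplicialIso

variable {V V' V'' : Type*}

theorem mem_of_subset {K : PreAbstractSimplicialComplex V} {s t : Finset V} (hs : s ∈ K)
    (hts : t ⊆ s) (ht : t.Nonempty) : t ∈ K := (K.isRelLowerSet_faces hs).2 hts ht

theorem nonempty_of_mem {K : PreAbstractSimplicialComplex V} {s : Finset V} (hs : s ∈ K) :
    s.Nonempty := (K.isRelLowerSet_faces hs).1

theorem mem_vertices_of_mem {K : PreAbstractSimplicialComplex V} {s : Finset V} (hs : s ∈ K)
    {x : V} (hx : x ∈ s) : x ∈ vertices K :=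
  mem_of_subset hs (Finset.singleton_subset_iff.2 hx) (Finset.singleton_nonempty x)

theorem mem_vertices_inf {K L : PreAbstractSimplicialComplex V} {s t : Finset V} (hs : s ∈ K)
    (ht : t ∈ L) {x : V} (hx : x ∈ s) (hx' : x ∈ t) : x ∈ vertices (K ⊓ L) :=
  ⟨mem_vertices_of_mem hs hx, mem_vertices_of_mem ht hx'⟩

theorem IsSimplicialIso.comp {K : PreAbstractSimplicialComplex V}
    {L : PreAbstractSimplicialComplex V'} {L' : PreAbstractSimplicialComplex V''} {f : V → V'}
    {g : V' → V''} (hg : IsSimplicialIso L L' g) (hf : IsSimplicialIso K L f) :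
    IsSimplicialIso K L' (g ∘ f) := by
  classical
  refine ⟨hg.1.comp hf.1, fun s hs => ?_⟩
  rw [hf.2 s hs, hg.2]
  · rw [Finset.image_image]
  · intro x hx
    rw [Finset.mem_coe, Finset.mem_image] at hx
    obtain ⟨y, hy, rfl⟩ := hx
    exact hf.1.mapsTo (hs hy)

end SimplicialIso

section Charts

variable {ι M N : Type*} [AddCommGroup M] [Module ℝ M] [AddCommGroup N] [Module ℝ N]
  {P : RootPairing ι ℝ M N} [P.IsRootSystem] (b : P.Base)
  [Finite ι] [P.IsCrystallographic] [P.IsReduced] [P.IsIrreducible] [Nonempty ι]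
  {V : Type*}

/-- The vertex of type `i` of the alcove `w`. -/
def vert (w : affineWeylGroup P) (i : Node b) : N := (w : N ≃ᵃ[ℝ] N) (fundamentalVertex b i)

variable {b}

theorem mem_alcoveVertices {w : affineWeylGroup P} {x : N} :
    x ∈ alcoveVertices b w ↔ ∃ i, vert b w i = x := by
  simp [alcoveVertices, vert]

theorem vert_mul (v w : affineWeylGroup P) (i : Node b) :
    vert b (v * w) i = (v : N ≃ᵃ[ℝ] N) (vert b w i) := rfl

theorem vert_type_eq {v w : affineWeylGroup P} {i j : Node b} (h : vert b v i = vert b w j) :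
    i = j := type_eq h

theorem vert_mul_simple_of_ne (w : affineWeylGroup P) {i j : Node b} (h : i ≠ j) :
    vert b (w * simpleReflection b j) i = vert b w i := by
  rw [vert_mul, vert, simpleReflection_fundamentalVertex h.symm, vert]

theorem eq_or_eq_mul_simple {v w : affineWeylGroup P} {i : Node b}
    (h : ∀ j, j ≠ i → vert b w j = vert b v j) : w = v ∨ w = v * simpleReflection b i := by
  have := eq_one_or_eq_simple (b := b) (w := v⁻¹ * w) (i := i) (fun j hj => by
    rw [coe_mul_apply]
    change (v⁻¹ : affineWeylGroup P).1 (vert b w j) = _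
    rw [h j hj, vert, coe_inv_apply_self])
  rcases this with h1 | h1
  · left; exact (inv_mul_eq_one.1 h1).symm
  · right; exact inv_mul_eq_iff_eq_mul.1 h1

theorem eq_of_vert_eq {v w : affineWeylGroup P} (h : ∀ j : Node b, vert b w j = vert b v j) :
    w = v := by
  rcases eq_or_eq_mul_simple (i := none) fun j _ => h j with h1 | h1
  · exact h1
  · have h2 : v⁻¹ * w = 1 := stabilizer_induction (b := b) (p := fun u => u = 1)
      (S := Set.univ) rfl (fun k hk => absurd (Set.mem_univ k) hk) (fun j _ => by
        rw [coe_mul_apply]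
        change (v⁻¹ : affineWeylGroup P).1 (vert b w j) = _
        rw [h j, vert, coe_inv_apply_self])
    exact (inv_mul_eq_one.1 h2).symm

theorem vert_mul_simple_self_ne (w : affineWeylGroup P) (i : Node b) :
    vert b (w * simpleReflection b i) i ≠ vert b w i := by
  intro h
  have : w * simpleReflection b i = w := eq_of_vert_eq (b := b) fun j => by
    by_cases hj : j = i
    · rw [hj, h]
    · exact vert_mul_simple_of_ne w hj
  exact simpleReflection_ne_one i (mul_eq_left.1 this)

theorem mem_vertices_coxeterComplex {x : N} :
    x ∈ vertices (coxeterComplex b) ↔ ∃ w i, vert b w i = x := by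
  constructor
  · rintro ⟨-, w, hw⟩
    exact ⟨w, mem_alcoveVertices.1 (hw (Finset.mem_singleton_self x))⟩
  · rintro ⟨w, i, rfl⟩
    exact ⟨Finset.singleton_nonempty _, w,
      Finset.singleton_subset_iff.2 (mem_alcoveVertices.2 ⟨i, rfl⟩)⟩

variable (b) in
open Classical in
/-- The image of the alcove `w` under the vertex map `F`. -/
def cell (F : N → V) (w : affineWeylGroup P) : Finset V := (alcoveVertices b w).image F

theorem mem_cell {F : N → V} {w : affineWeylGroup P} {x : V} :
    x ∈ cell b F w ↔ ∃ i, F (vert b w i) = x := by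
  classical
  rw [cell, Finset.mem_image]
  constructor
  · rintro ⟨y, hy, rfl⟩
    obtain ⟨i, rfl⟩ := mem_alcoveVertices.1 hy
    exact ⟨i, rfl⟩
  · rintro ⟨i, rfl⟩
    exact ⟨_, mem_alcoveVertices.2 ⟨i, rfl⟩, rfl⟩

theorem vert_mem_cell (F : N → V) (w : affineWeylGroup P) (i : Node b) :
    F (vert b w i) ∈ cell b F w := mem_cell.2 ⟨i, rfl⟩

theorem cell_congr {F F' : N → V} {v w : affineWeylGroup P}
    (h : ∀ i, F (vert b v i) = F' (vert b w i)) : cell b F v = cell b F' w := by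
  ext x
  simp only [mem_cell, h]

theorem cell_nonempty (F : N → V) (w : affineWeylGroup P) : (cell b F w).Nonempty :=
  ⟨_, vert_mem_cell F w none⟩

variable (b) in
/-- `F` identifies the Coxeter complex with the complex `A`. -/
structure IsChart (A : PreAbstractSimplicialComplex V) (F : N → V) : Prop where
  inj : ∀ {v i w j}, F (vert b v i) = F (vert b w j) → vert b v i = vert b w j
  mem_iff : ∀ s, s ∈ A ↔ s.Nonempty ∧ ∃ w, s ⊆ cell b F w

/-- Replaces simplicial isomorphisms by conditions on typed vertices and cells, where the group acts
and the values of `F` off the vertices play no role. -/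
theorem isSimplicialIso_iff_isChart {A : PreAbstractSimplicialComplex V} {F : N → V} :
    IsSimplicialIso (coxeterComplex b) A F ↔ IsChart b A F := by
  classical
  constructor
  · intro h
    have hinj : ∀ {v i w j}, F (vert b v i) = F (vert b w j) → vert b v i = vert b w j :=
      fun {v i w j} e => h.1.injOn (mem_vertices_coxeterComplex.2 ⟨v, i, rfl⟩)
        (mem_vertices_coxeterComplex.2 ⟨w, j, rfl⟩) e
    have hcell : ∀ w, cell b F w ∈ A := by
      intro w
      have := (h.2 (alcoveVertices b w) fun x hx => by
        obtain ⟨i, rfl⟩ := mem_alcoveVertices.1 hx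
        exact mem_vertices_coxeterComplex.2 ⟨w, i, rfl⟩).1
        ⟨⟨_, mem_alcoveVertices.2 ⟨none, rfl⟩⟩, w, Finset.Subset.refl _⟩
      exact this
    refine ⟨hinj, fun s => ⟨fun hs => ⟨nonempty_of_mem hs, ?_⟩, ?_⟩⟩
    · have hsub : ∀ x ∈ s, ∃ y ∈ vertices (coxeterComplex b), F y = x :=
        fun x hx => h.1.surjOn (mem_vertices_of_mem hs hx)
      choose! G hG hFG using hsub
      have himg : (s.image G).image F = s := by
        rw [Finset.image_image]
        conv_rhs => rw [← Finset.image_id (s := s)]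
        exact Finset.image_congr fun x hx => hFG x hx
      have hsub : ((s.image G : Finset N) : Set N) ⊆ vertices (coxeterComplex b) := by
        intro y hy
        rw [Finset.mem_coe, Finset.mem_image] at hy
        obtain ⟨x, hx, rfl⟩ := hy
        exact hG x hx
      have hmem := (h.2 (s.image G) hsub).2 (by rw [himg]; exact hs)
      obtain ⟨-, w, hw⟩ := hmem
      refine ⟨w, ?_⟩
      intro x hx
      obtain ⟨i, hi⟩ := mem_alcoveVertices.1 (hw (Finset.mem_image_of_mem G hx))
      exact mem_cell.2 ⟨i, by rw [hi, hFG x hx]⟩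
    · rintro ⟨hs, w, hw⟩
      exact mem_of_subset (hcell w) hw hs
  · intro h
    refine ⟨⟨?_, ?_, ?_⟩, ?_⟩
    · intro x hx
      obtain ⟨w, i, rfl⟩ := mem_vertices_coxeterComplex.1 hx
      exact (h.mem_iff _).2 ⟨Finset.singleton_nonempty _, w,
        Finset.singleton_subset_iff.2 (vert_mem_cell F w i)⟩
    · intro x hx y hy e
      obtain ⟨v, i, rfl⟩ := mem_vertices_coxeterComplex.1 hx
      obtain ⟨w, j, rfl⟩ := mem_vertices_coxeterComplex.1 hy
      exact h.inj e
    · intro x hx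
      obtain ⟨-, w, hw⟩ := (h.mem_iff _).1 hx
      obtain ⟨i, hi⟩ := mem_cell.1 (hw (Finset.mem_singleton_self x))
      exact ⟨_, mem_vertices_coxeterComplex.2 ⟨w, i, rfl⟩, hi⟩
    · intro s hs
      rw [h.mem_iff, Finset.image_nonempty]
      constructor
      · rintro ⟨hne, w, hw⟩
        exact ⟨hne, w, fun x hx => by
          obtain ⟨y, hy, rfl⟩ := Finset.mem_image.1 hx
          obtain ⟨i, rfl⟩ := mem_alcoveVertices.1 (hw hy)
          exact vert_mem_cell F w i⟩
      · rintro ⟨hne, w, hw⟩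
        refine ⟨hne, w, fun y hy => ?_⟩
        obtain ⟨i, hi⟩ := mem_cell.1 (hw (Finset.mem_image_of_mem F hy))
        obtain ⟨v, j, rfl⟩ := mem_vertices_coxeterComplex.1 (hs hy)
        exact mem_alcoveVertices.2 ⟨i, h.inj hi⟩

namespace IsChart

variable {A : PreAbstractSimplicialComplex V} {F F' : N → V}

theorem cell_mem (h : IsChart b A F) (w : affineWeylGroup P) : cell b F w ∈ A :=
  (h.mem_iff _).2 ⟨cell_nonempty F w, w, Finset.Subset.refl _⟩

theorem type_eq (h : IsChart b A F) {v w : affineWeylGroup P} {i j : Node b}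
    (e : F (vert b v i) = F (vert b w j)) : i = j := vert_type_eq (h.inj e)

theorem card_cell (h : IsChart b A F) (w : affineWeylGroup P) :
    (cell b F w).card = Fintype.card (Node b) := by
  classical
  have : cell b F w = Finset.univ.image fun i => F (vert b w i) := by
    ext x
    simp [mem_cell]
  rw [this, Finset.card_image_of_injective _ fun i j e => h.type_eq e, Finset.card_univ]

theorem mem_cell_iff (h : IsChart b A F) {v w : affineWeylGroup P} {i : Node b} :
    F (vert b v i) ∈ cell b F w ↔ vert b v i = vert b w i := by
  constructor
  · intro hm
    obtain ⟨j, hj⟩ := mem_cell.1 hm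
    obtain rfl := h.type_eq hj
    exact (h.inj hj).symm
  · intro e
    rw [e]
    exact vert_mem_cell F w i

theorem cell_injective (h : IsChart b A F) {v w : affineWeylGroup P}
    (e : cell b F v = cell b F w) : v = w :=
  eq_of_vert_eq (b := b) fun i => h.mem_cell_iff.1 (e ▸ vert_mem_cell F v i)

theorem comp {A' : PreAbstractSimplicialComplex V} {g : V → V} (hg : IsSimplicialIso A' A g)
    (h : IsChart b A' F) : IsChart b A (g ∘ F) :=
  isSimplicialIso_iff_isChart.1 (hg.comp (isSimplicialIso_iff_isChart.2 h))

theorem cell_translate (F : N → V) (u w : affineWeylGroup P) :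
    cell b (F ∘ (u : N ≃ᵃ[ℝ] N)) w = cell b F (u * w) :=
  cell_congr fun _ => rfl

theorem translate (h : IsChart b A F) (u : affineWeylGroup P) :
    IsChart b A (F ∘ (u : N ≃ᵃ[ℝ] N)) where
  inj {v i w j} e := (u : N ≃ᵃ[ℝ] N).injective (h.inj (v := u * v) (w := u * w) e)
  mem_iff s := by
    rw [h.mem_iff]
    refine and_congr_right fun _ => ⟨?_, ?_⟩
    · rintro ⟨w, hw⟩
      exact ⟨u⁻¹ * w, by rwa [cell_translate, mul_inv_cancel_left]⟩
    · rintro ⟨w, hw⟩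
      exact ⟨u * w, by rwa [← cell_translate]⟩

/-- Two charts of the same complex that agree on an alcove agree everywhere. -/
theorem rigid (h : IsChart b A F) (h' : IsChart b A F') {y : affineWeylGroup P}
    (hy : ∀ i, F (vert b y i) = F' (vert b y i)) (w : affineWeylGroup P) (i : Node b) :
    F (vert b w i) = F' (vert b w i) := by
  suffices key : ∀ w : affineWeylGroup P, ∀ i, F (vert b (y * w) i) = F' (vert b (y * w) i) by
    simpa using key (y⁻¹ * w) i
  refine weyl_induction (b := b) (by simpa using hy) ?_
  intro w j ih i
  rw [← mul_assoc]
  generalize y * w = u at ih ⊢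
  by_cases hij : i = j
  swap
  · rw [vert_mul_simple_of_ne u hij, ih]
  subst hij
  -- The `F`-cell of `u s_i` is contained in some `F'`-cell `w'` that shares a panel with `u`. Hence
  -- `w'` is `u` or `u s_i`, and injectivity of `F` rules out `u`.
  obtain ⟨-, w', hw'⟩ := (h'.mem_iff _).1 (h.cell_mem (u * simpleReflection b i))
  have hpanel : ∀ k, k ≠ i → vert b w' k = vert b u k := by
    intro k hk
    have h1 := hw' (vert_mem_cell F (u * simpleReflection b i) k)
    rw [vert_mul_simple_of_ne u hk, ih, h'.mem_cell_iff] at h1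
    exact h1.symm
  obtain ⟨k, hk⟩ := mem_cell.1 (hw' (vert_mem_cell F (u * simpleReflection b i) i))
  have hki : k = i := by
    by_contra hki
    rw [hpanel k hki, ← ih] at hk
    exact hki (h.type_eq hk)
  subst hki
  rcases eq_or_eq_mul_simple hpanel with rfl | rfl
  · rw [← ih] at hk
    exact absurd (h.inj hk).symm (vert_mul_simple_self_ne _ _)
  · exact hk.symm

end IsChart

end Charts

end AffineBuilding

end

noncomputable section

namespace AffineBuilding

set_option linter.unusedSectionVars false

/-! ### Types and the Weyl distance of a building -/

namespace Building

variable {ι M N : Type*} [AddCommGroup M] [Module ℝ M] [AddCommGroup N] [Module ℝ N]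
  {P : RootPairing ι ℝ M N} [P.IsRootSystem] {b : P.Base}
  [Finite ι] [P.IsCrystallographic] [P.IsReduced] [P.IsIrreducible] [Nonempty ι]
  {V : Type*} {X : Building b V}

theorem mem_complex {A : PreAbstractSimplicialComplex V} (hA : A ∈ X.apartments) {s : Finset V}
    (hs : s ∈ A) : s ∈ X.complex := X.apartment_le A hA hs

theorem exists_chart {A : PreAbstractSimplicialComplex V} (hA : A ∈ X.apartments) :
    ∃ F : N → V, IsChart b A F :=
  (X.apartment_iso A hA).imp fun _ h => isSimplicialIso_iff_isChart.1 h

theorem exists_cell_eq {A : PreAbstractSimplicialComplex V} (hA : A ∈ X.apartments) {F : N → V}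
    (hF : IsChart b A F) {c : Finset V} (hc : IsChamber X.complex c) (hcA : c ∈ A) :
    ∃ w, cell b F w = c := by
  obtain ⟨-, w, hw⟩ := (hF.mem_iff c).1 hcA
  exact ⟨w, (Maximal.eq_of_le hc (mem_complex hA (hF.cell_mem w)) hw).symm⟩

theorem card_eq {c : Finset V} (hc : IsChamber X.complex c) :
    c.card = Fintype.card (Node b) := by
  obtain ⟨A, hA, hcA, -⟩ := X.exists_apartment c c hc hc
  obtain ⟨F, hF⟩ := exists_chart hA
  obtain ⟨w, rfl⟩ := exists_cell_eq hA hF hc hcA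
  exact hF.card_cell w

/-- The cell lies in a chamber, and all chambers have as many vertices as a cell. -/
theorem isChamber_cell {A : PreAbstractSimplicialComplex V} (hA : A ∈ X.apartments) {F : N → V}
    (hF : IsChart b A F) (w : affineWeylGroup P) : IsChamber X.complex (cell b F w) := by
  obtain ⟨c, hc, hsub⟩ := X.exists_chamber _ (mem_complex hA (hF.cell_mem w))
  rw [Finset.eq_of_subset_of_card_le hsub (by rw [card_eq hc, hF.card_cell])]
  exact hc

/-- Charts of two apartments that agree on a common chamber are related by an isomorphism that
fixes the intersection. -/
theorem exists_transition {A A' : PreAbstractSimplicialComplex V} (hA : A ∈ X.apartments)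
    (hA' : A' ∈ X.apartments) {F F' : N → V} (hF : IsChart b A F) (hF' : IsChart b A' F')
    {y : affineWeylGroup P} (hy : ∀ i, F (vert b y i) = F' (vert b y i)) :
    ∃ g : V → V, IsSimplicialIso A' A g ∧ (∀ x ∈ vertices (A ⊓ A'), g x = x) ∧
      ∀ w i, g (F' (vert b w i)) = F (vert b w i) := by
  have hcell : cell b F y = cell b F' y := cell_congr hy
  obtain ⟨g, hg, hfix⟩ := X.exists_iso A hA A' hA'
    ⟨cell b F y, hF.cell_mem y, by rw [hcell]; exact hF'.cell_mem y⟩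
  refine ⟨g, hg, hfix, fun w i => ((hF.rigid (hF'.comp hg) (y := y) fun j => ?_) w i).symm⟩
  rw [Function.comp_apply, ← hy]
  exact (hfix _ (mem_vertices_inf (hF.cell_mem y) (hF'.cell_mem y) (vert_mem_cell F y j)
    (hcell ▸ vert_mem_cell F y j))).symm

/-- Charts of two apartments that agree on a common chamber agree at every common vertex. -/
theorem vert_eq_of_common {A A' : PreAbstractSimplicialComplex V} (hA : A ∈ X.apartments)
    (hA' : A' ∈ X.apartments) {F F' : N → V} (hF : IsChart b A F) (hF' : IsChart b A' F')
    {y : affineWeylGroup P} (hy : ∀ i, F (vert b y i) = F' (vert b y i))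
    {v w : affineWeylGroup P} {i j : Node b} (h : F (vert b v i) = F' (vert b w j)) :
    vert b v i = vert b w j := by
  obtain ⟨g, -, hfix, hg⟩ := exists_transition hA hA' hF hF' hy
  have := hg w j
  rw [← h, hfix _ (mem_vertices_inf (hF.cell_mem v) (hF'.cell_mem w) (vert_mem_cell F v i)
    (h ▸ vert_mem_cell F' w j))] at this
  exact hF.inj this

namespace Marking

variable (m : X.Marking)

theorem isChart_emb : IsChart b m.apartment m.emb := isSimplicialIso_iff_isChart.1 m.isSimplicialIso

theorem chamberAt_eq_cell (w : affineWeylGroup P) : m.chamberAt w = cell b m.emb w := rfl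

/-- `F` is a chart of an apartment that extends the marking of the chamber `1`. -/
def IsBased (F : N → V) : Prop :=
  (∃ A ∈ X.apartments, IsChart b A F) ∧ ∀ i, F (vert b 1 i) = m.emb (vert b 1 i)

theorem exists_isBased {c : Finset V} (hc : IsChamber X.complex c) :
    ∃ F, m.IsBased F ∧ ∃ w, cell b F w = c := by
  have h1 := isChamber_cell m.mem_apartments m.isChart_emb 1
  obtain ⟨A, hA, h1A, hcA⟩ := X.exists_apartment _ _ h1 hc
  obtain ⟨g, hg, hfix⟩ := X.exists_iso A hA m.apartment m.mem_apartments
    ⟨_, h1A, m.isChart_emb.cell_mem 1⟩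
  have hF : IsChart b A (g ∘ m.emb) := m.isChart_emb.comp hg
  refine ⟨g ∘ m.emb, ⟨⟨A, hA, hF⟩, fun i => ?_⟩, exists_cell_eq hA hF hc hcA⟩
  exact hfix _ (mem_vertices_inf h1A (m.isChart_emb.cell_mem 1) (vert_mem_cell _ _ i)
    (vert_mem_cell _ _ i))

open Classical in
-- The type of a vertex is read off in any chart that extends the marking of the chamber `1`. Two
-- such charts agree at common vertices, and they reach every chamber.
theorem exists_isTypeFunction : ∃ τ, m.IsTypeFunction τ := by
  let Q : V → Node b → Prop := fun x i => ∃ F w, m.IsBased F ∧ F (vert b w i) = x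
  have hQ : ∀ {F F' : N → V}, m.IsBased F → m.IsBased F' → ∀ {v w i j},
      F (vert b v i) = F' (vert b w j) → i = j := by
    rintro F F' ⟨⟨A, hA, hF⟩, h1⟩ ⟨⟨A', hA', hF'⟩, h1'⟩ v w i j h
    exact vert_type_eq
      (vert_eq_of_common hA hA' hF hF' (y := 1) (fun k => by rw [h1, h1']) h)
  let τ : V → Node b := fun x => if h : ∃ i, Q x i then h.choose else none
  have hτ : ∀ F, m.IsBased F → ∀ w i, τ (F (vert b w i)) = i := by
    intro F hF w i
    have h : ∃ j, Q (F (vert b w i)) j := ⟨i, F, w, hF, rfl⟩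
    simp only [τ, dif_pos h]
    obtain ⟨F', w', hF', he⟩ := h.choose_spec
    exact hQ hF' hF he
  refine ⟨τ, fun w i => hτ m.emb ⟨⟨_, m.mem_apartments, m.isChart_emb⟩, fun _ => rfl⟩ w i, ?_⟩
  intro c hc
  obtain ⟨F, hF, w, rfl⟩ := m.exists_isBased hc
  refine ⟨fun _ _ => Set.mem_univ _, ?_, fun i _ => ⟨_, vert_mem_cell F w i, hτ F hF w i⟩⟩
  intro x hx y hy hxy
  obtain ⟨i, rfl⟩ := mem_cell.1 hx
  obtain ⟨j, rfl⟩ := mem_cell.1 hy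
  rw [hτ F hF, hτ F hF] at hxy
  rw [hxy]

theorem isTypeFunction_typeFunction : m.IsTypeFunction m.typeFunction := by
  rw [typeFunction, dif_pos m.exists_isTypeFunction]
  exact m.exists_isTypeFunction.choose_spec

theorem typeFunction_emb (w : affineWeylGroup P) (i : Node b) :
    m.typeFunction (m.emb (vert b w i)) = i := m.isTypeFunction_typeFunction.1 w i

variable {m}

theorem eq_of_typeFunction_eq {c : Finset V} (hc : IsChamber X.complex c) {x y : V} (hx : x ∈ c)
    (hy : y ∈ c) (h : m.typeFunction x = m.typeFunction y) : x = y :=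
  (m.isTypeFunction_typeFunction.2 c hc).injOn hx hy h

theorem exists_mem_typeFunction_eq {c : Finset V} (hc : IsChamber X.complex c) (i : Node b) :
    ∃ x ∈ c, m.typeFunction x = i :=
  (m.isTypeFunction_typeFunction.2 c hc).surjOn (Set.mem_univ i)

variable (m) in
/-- A type preserving chart of an apartment. -/
structure IsTypedChart (A : PreAbstractSimplicialComplex V) (F : N → V) : Prop where
  mem : A ∈ X.apartments
  isChart : IsChart b A F
  type : ∀ w i, m.typeFunction (F (vert b w i)) = i

/-- Types propagate across panels: crossing one replaces a single vertex, whose type must be the one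
missing from the panel. -/
theorem isTypedChart_of_cell {A : PreAbstractSimplicialComplex V} (hA : A ∈ X.apartments)
    {F : N → V} (hF : IsChart b A F) {y : affineWeylGroup P}
    (hy : ∀ i, m.typeFunction (F (vert b y i)) = i) : m.IsTypedChart A F := by
  refine ⟨hA, hF, ?_⟩
  suffices key : ∀ w : affineWeylGroup P, ∀ i, m.typeFunction (F (vert b (y * w) i)) = i by
    intro w i
    simpa using key (y⁻¹ * w) i
  refine weyl_induction (b := b) (by simpa using hy) ?_
  intro w j ih i
  rw [← mul_assoc]
  generalize y * w = u at ih ⊢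
  by_cases hij : i = j
  swap
  · rw [vert_mul_simple_of_ne u hij, ih]
  subst hij
  obtain ⟨x, hx, hxi⟩ := exists_mem_typeFunction_eq (m := m)
    (isChamber_cell hA hF (u * simpleReflection b i)) i
  obtain ⟨k, rfl⟩ := mem_cell.1 hx
  by_cases hk : k = i
  · subst hk
    exact hxi
  · rw [vert_mul_simple_of_ne u hk, ih] at hxi
    exact absurd hxi hk

theorem isTypedChart_emb : m.IsTypedChart m.apartment m.emb :=
  ⟨m.mem_apartments, m.isChart_emb, m.typeFunction_emb⟩

namespace IsTypedChart

variable {A A' : PreAbstractSimplicialComplex V} {F F' : N → V}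

theorem isChamber (h : m.IsTypedChart A F) (w : affineWeylGroup P) :
    IsChamber X.complex (cell b F w) := isChamber_cell h.mem h.isChart w

theorem translate (h : m.IsTypedChart A F) (u : affineWeylGroup P) :
    m.IsTypedChart A (F ∘ (u : N ≃ᵃ[ℝ] N)) :=
  ⟨h.mem, h.isChart.translate u, fun w i => h.type (u * w) i⟩

/-- Type preserving charts with a common cell agree on its vertices. -/
theorem vert_eq (h : m.IsTypedChart A F) (h' : m.IsTypedChart A' F') {v w : affineWeylGroup P}
    (e : cell b F v = cell b F' w) (i : Node b) : F (vert b v i) = F' (vert b w i) :=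
  eq_of_typeFunction_eq (h.isChamber v) (vert_mem_cell F v i) (e ▸ vert_mem_cell F' w i)
    (by rw [h.type, h'.type])

theorem cell_unique (h : m.IsTypedChart A F) (h' : m.IsTypedChart A' F')
    {y v w : affineWeylGroup P} (hy : cell b F y = cell b F' y) (e : cell b F v = cell b F' w) :
    v = w :=
  eq_of_vert_eq (b := b) fun i => vert_eq_of_common h.mem h'.mem h.isChart h'.isChart
    (h.vert_eq h' hy) (h.vert_eq h' e i)

end IsTypedChart

/-- A based chart through `c` is carried to `A` by an isomorphism fixing `c`, then precomposed with
a group element to put `c` at position `y`. -/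
theorem exists_isTypedChart {A : PreAbstractSimplicialComplex V} (hA : A ∈ X.apartments)
    {c : Finset V} (hc : IsChamber X.complex c) (hcA : c ∈ A) (y : affineWeylGroup P) :
    ∃ F, m.IsTypedChart A F ∧ cell b F y = c := by
  obtain ⟨F₀, ⟨⟨A₀, hA₀, hF₀⟩, h1⟩, w, rfl⟩ := m.exists_isBased hc
  have ht : m.IsTypedChart A₀ F₀ :=
    isTypedChart_of_cell hA₀ hF₀ (y := 1) fun i => by rw [h1, typeFunction_emb]
  obtain ⟨g, hg, hfix⟩ := X.exists_iso A hA A₀ hA₀ ⟨_, hcA, hF₀.cell_mem w⟩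
  have hgw : ∀ i, g (F₀ (vert b w i)) = F₀ (vert b w i) := fun i =>
    hfix _ (mem_vertices_inf hcA (hF₀.cell_mem w) (vert_mem_cell _ _ i) (vert_mem_cell _ _ i))
  have hF : m.IsTypedChart A (g ∘ F₀) := isTypedChart_of_cell hA (hF₀.comp hg) (y := w)
    fun i => by rw [Function.comp_apply, hgw, ht.type]
  refine ⟨_, hF.translate (w * y⁻¹), ?_⟩
  rw [IsChart.cell_translate, inv_mul_cancel_right]
  exact cell_congr hgw

variable (X) in
/-- The chambers of a building. -/
abbrev Chamber : Type _ := {c : Finset V // IsChamber X.complex c}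

variable (m) in
/-- `w` is the distance from `c` to `d`. -/
def IsDist (c d : Chamber X) (w : affineWeylGroup P) : Prop :=
  ∃ A F, m.IsTypedChart A F ∧ cell b F 1 = c.1 ∧ cell b F w = d.1

theorem exists_isTypedChart_pair (c d : Chamber X) (y : affineWeylGroup P) :
    ∃ A F, m.IsTypedChart A F ∧ cell b F y = c.1 ∧ ∃ w, cell b F w = d.1 := by
  obtain ⟨A, hA, hcA, hdA⟩ := X.exists_apartment c.1 d.1 c.2 d.2
  obtain ⟨F, hF, h1⟩ := exists_isTypedChart (m := m) hA c.2 hcA y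
  exact ⟨A, F, hF, h1, exists_cell_eq hA hF.isChart d.2 hdA⟩

variable (m) in
theorem exists_isDist (c d : Chamber X) : ∃ w, m.IsDist c d w := by
  obtain ⟨A, F, hF, h1, w, hw⟩ := exists_isTypedChart_pair (m := m) c d 1
  exact ⟨w, A, F, hF, h1, hw⟩

theorem IsDist.unique {c d : Chamber X} {v w : affineWeylGroup P} (hv : m.IsDist c d v)
    (hw : m.IsDist c d w) : v = w := by
  obtain ⟨A, F, hF, h1, h2⟩ := hv
  obtain ⟨A', F', hF', h1', h2'⟩ := hw
  exact hF.cell_unique hF' (h1.trans h1'.symm) (h2.trans h2'.symm)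

variable (m) in
/-- The distance function on chambers with values in the affine Weyl group. -/
def dist (c d : Chamber X) : affineWeylGroup P := (m.exists_isDist c d).choose

theorem dist_cell {A : PreAbstractSimplicialComplex V} {F : N → V} (hF : m.IsTypedChart A F)
    {c d : Chamber X} {v w : affineWeylGroup P} (hv : cell b F v = c.1) (hw : cell b F w = d.1) :
    m.dist c d = v⁻¹ * w := by
  refine (m.exists_isDist c d).choose_spec.unique ⟨A, _, hF.translate v, ?_, ?_⟩
  · rw [IsChart.cell_translate, mul_one, hv]
  · rw [IsChart.cell_translate, mul_inv_cancel_left, hw]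

/-- The cell of a type preserving chart, as a chamber. -/
def IsTypedChart.chamber {A : PreAbstractSimplicialComplex V} {F : N → V}
    (hF : m.IsTypedChart A F) (w : affineWeylGroup P) : Chamber X := ⟨cell b F w, hF.isChamber w⟩

theorem IsTypedChart.isIsometry {A : PreAbstractSimplicialComplex V} {F : N → V}
    (hF : m.IsTypedChart A F) : IsIsometry m.dist hF.chamber :=
  fun _ _ => dist_cell hF rfl rfl

theorem adjacent_iff_vertices [Nonempty b.support] {i : Node b} {c d : Chamber X} :
    m.Adjacent i c.1 d.1 ↔ ∀ x ∈ c.1, m.typeFunction x ≠ i → x ∈ d.1 := by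
  classical
  constructor
  · rintro ⟨-, -, p, -, hp, hpc, hpd⟩ x hx hxi
    obtain ⟨y, hy, hyx⟩ := (hp _).2 hxi
    rw [← eq_of_typeFunction_eq c.2 (hpc hy) hx hyx]
    exact hpd hy
  · intro h
    obtain ⟨z, hz, hzi⟩ := exists_mem_typeFunction_eq (m := m) c.2 i
    have hmem : ∀ x, x ∈ c.1.erase z ↔ x ∈ c.1 ∧ m.typeFunction x ≠ i := by
      intro x
      rw [Finset.mem_erase, and_comm]
      refine and_congr_right fun hx => ?_
      rw [not_iff_not, ← hzi]
      exact ⟨fun e => by rw [e], fun e => eq_of_typeFunction_eq c.2 hx hz e⟩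
    have hcot : m.HasCotype (c.1.erase z) i := by
      intro j
      constructor
      · rintro ⟨x, hx, rfl⟩
        exact ((hmem x).1 hx).2
      · intro hj
        obtain ⟨x, hx, hxj⟩ := exists_mem_typeFunction_eq (m := m) c.2 j
        exact ⟨x, (hmem x).2 ⟨hx, by rwa [hxj]⟩, hxj⟩
    -- A second type is needed because simplices, and so panels, are nonempty.
    obtain ⟨j, hj⟩ := exists_ne i
    obtain ⟨x, hx, -⟩ := (hcot j).2 hj
    refine ⟨c.2, d.2, c.1.erase z, ⟨mem_of_subset c.2.prop (Finset.erase_subset _ _) ⟨x, hx⟩,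
      c.1, c.2, Finset.erase_subset _ _, (Finset.card_erase_add_one hz).symm⟩, hcot,
      Finset.erase_subset _ _, fun x hx => h x ((hmem x).1 hx).1 ((hmem x).1 hx).2⟩

theorem adjacent_iff_dist [Nonempty b.support] {i : Node b} {c d : Chamber X} :
    m.Adjacent i c.1 d.1 ↔ m.dist c d = 1 ∨ m.dist c d = simpleReflection b i := by
  obtain ⟨A, F, hF, h1, w, hw⟩ := exists_isTypedChart_pair (m := m) c d 1
  have hd := dist_cell hF h1 hw
  rw [inv_one, one_mul] at hd
  rw [hd, adjacent_iff_vertices]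
  constructor
  · intro h
    have := eq_or_eq_mul_simple (b := b) (v := 1) (w := w) (i := i) fun j hj => by
      have h2 := h (F (vert b 1 j)) (h1 ▸ vert_mem_cell F 1 j) (by rwa [hF.type])
      rw [← hw] at h2
      exact (hF.isChart.mem_cell_iff.1 h2).symm
    rwa [one_mul] at this
  · intro h x hx hxi
    rw [← h1] at hx
    obtain ⟨j, rfl⟩ := mem_cell.1 hx
    rw [hF.type] at hxi
    rw [← hw, hF.isChart.mem_cell_iff]
    rcases h with rfl | rfl
    · rfl
    · rw [← one_mul (simpleReflection b i), vert_mul_simple_of_ne 1 hxi]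

theorem isWeylDistance : IsWeylDistance b m.dist where
  eq_one_iff c d := by
    obtain ⟨A, F, hF, h1, w, hw⟩ := exists_isTypedChart_pair (m := m) c d 1
    rw [dist_cell hF h1 hw, inv_one, one_mul]
    constructor
    · rintro rfl
      exact Subtype.ext (h1.symm.trans hw)
    · rintro rfl
      exact hF.isChart.cell_injective (hw.trans h1.symm)
  inv c d := by
    obtain ⟨A, F, hF, h1, w, hw⟩ := exists_isTypedChart_pair (m := m) c d 1
    rw [dist_cell hF h1 hw, dist_cell hF hw h1]
    group
  exists_step c d i := by
    obtain ⟨A, F, hF, h1, w, hw⟩ := exists_isTypedChart_pair (m := m) c d 1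
    refine ⟨hF.chamber (w * simpleReflection b i), ?_, ?_⟩
    · rw [dist_cell hF hw rfl, inv_mul_cancel_left]
    · rw [dist_cell hF h1 rfl, dist_cell hF h1 hw, mul_assoc]
  step {c d d' i} hd := by
    obtain ⟨A₁, F₁, hF₁, h1₁, w₁, hw₁⟩ := exists_isTypedChart_pair (m := m) d d' 1
    rw [dist_cell hF₁ h1₁ hw₁, inv_one, one_mul] at hd
    obtain ⟨A, F, hF, h1, w, hw⟩ := exists_isTypedChart_pair (m := m) c d 1
    obtain ⟨A', F', hF', h1', w', hw'⟩ := exists_isTypedChart_pair (m := m) c d' 1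
    rw [dist_cell hF h1 hw, dist_cell hF' h1' hw', inv_one, one_mul, one_mul, or_comm]
    refine eq_or_eq_mul_simple fun j hj => ?_
    -- The vertices of type `j ≠ i` are shared by `d` and `d'`, so charts based at `c` put them at
    -- the same place; `w` and `w'` then differ at most across the panel of cotype `i`.
    have h2 : F (vert b w j) = F₁ (vert b 1 j) := hF.vert_eq hF₁ (hw.trans h1₁.symm) j
    have h3 : F' (vert b w' j) = F₁ (vert b w₁ j) := hF'.vert_eq hF₁ (hw'.trans hw₁.symm) j
    rw [hd, ← one_mul (simpleReflection b i), vert_mul_simple_of_ne 1 hj] at h3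
    exact (vert_eq_of_common hF.mem hF'.mem hF.isChart hF'.isChart
      (hF.vert_eq hF' (h1.trans h1'.symm)) (h2.trans h3.symm)).symm

/-- Sending each vertex of an alcove to the vertex of the same type in its image gives a copy of the
Coxeter complex, which completeness makes an apartment. -/
theorem exists_isTypedChart_of_isIsometry (hX : X.IsComplete)
    {φ : affineWeylGroup P → Chamber X} (hφ : IsIsometry m.dist φ) :
    ∃ A F, m.IsTypedChart A F ∧ ∀ w, cell b F w = (φ w).1 := by
  classical
  have hpair : ∀ v w, ∃ A F, m.IsTypedChart A F ∧ cell b F v = (φ v).1 ∧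
      cell b F w = (φ w).1 := by
    intro v w
    obtain ⟨A, F, hF, hv, u, hu⟩ := exists_isTypedChart_pair (m := m) (φ v) (φ w) v
    have h1 := dist_cell hF hv hu
    rw [hφ] at h1
    rw [← mul_left_cancel h1] at hu
    exact ⟨A, F, hF, hv, hu⟩
  choose x hx hxt using fun (w : affineWeylGroup P) (i : Node b) =>
    exists_mem_typeFunction_eq (m := m) (φ w).2 i
  have hx_eq : ∀ {A F}, m.IsTypedChart A F → ∀ {v}, cell b F v = (φ v).1 → ∀ i,
      x v i = F (vert b v i) := fun {A F} hF v hv i =>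
    eq_of_typeFunction_eq (φ v).2 (hx v i) (hv ▸ vert_mem_cell F v i) (by rw [hxt, hF.type])
  -- Well-definedness and injectivity concern two chambers at a time, so they can be checked in a
  -- common apartment.
  have hwd : ∀ {v w i j}, vert b v i = vert b w j ↔ x v i = x w j := by
    intro v w i j
    obtain ⟨A, F, hF, hv, hw⟩ := hpair v w
    rw [hx_eq hF hv, hx_eq hF hw]
    exact ⟨fun e => by rw [e], fun e => hF.isChart.inj e⟩
  let F : N → V := fun p => if h : ∃ q : affineWeylGroup P × Node b, vert b q.1 q.2 = p then
    x h.choose.1 h.choose.2 else x 1 none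
  have hF : ∀ w i, F (vert b w i) = x w i := by
    intro w i
    have h : ∃ q : affineWeylGroup P × Node b, vert b q.1 q.2 = vert b w i := ⟨(w, i), rfl⟩
    simp only [F, dif_pos h]
    exact hwd.1 h.choose_spec
  have hcell : ∀ w, cell b F w = (φ w).1 := by
    intro w
    refine Finset.eq_of_subset_of_card_le (fun y hy => ?_) ?_
    · obtain ⟨i, rfl⟩ := mem_cell.1 hy
      rw [hF]
      exact hx w i
    · obtain ⟨A, G, hG, hw, -⟩ := hpair w w
      rw [← hw, show cell b G w = cell b F w from cell_congr fun i => by rw [hF, hx_eq hG hw]]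
  let A : PreAbstractSimplicialComplex V :=
    { faces := {s | s.Nonempty ∧ ∃ w, s ⊆ cell b F w}
      isRelLowerSet_faces := fun _ h =>
        ⟨h.1, fun _ hts ht => ⟨ht, h.2.imp fun _ hw => Finset.Subset.trans hts hw⟩⟩ }
  have hA : IsChart b A F := ⟨fun {v i w j} e => by rwa [hF, hF, ← hwd] at e, fun s => Iff.rfl⟩
  have hAX : A ∈ X.apartments := by
    refine hX A ?_ ⟨F, isSimplicialIso_iff_isChart.2 hA⟩
    rintro s ⟨hs, w, hw⟩
    exact mem_of_subset (φ w).2.prop (hcell w ▸ hw) hs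
  exact ⟨A, F, ⟨hAX, hA, fun w i => by rw [hF, hxt]⟩, hcell⟩

end Marking

end Building

end AffineBuilding

end

noncomputable section

namespace AffineBuilding

set_option linter.unusedSectionVars false

/-! ### Subsectors of the opposite Weyl chamber and crossings -/

section Sectors

variable {ι M N : Type*} [AddCommGroup M] [Module ℝ M] [AddCommGroup N] [Module ℝ N]
  {P : RootPairing ι ℝ M N} [P.IsRootSystem] (b : P.Base)
  [Finite ι] [P.IsCrystallographic] [P.IsReduced] [P.IsIrreducible] [Nonempty ι]

theorem root'_reflectionPerm (γ α : ι) (x : N) :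
    P.root' (P.reflectionPerm γ α) x = P.root' α (P.coreflection γ x) := by
  rw [RootPairing.coreflection_apply]
  simp only [RootPairing.root', RootPairing.root_reflectionPerm,
    RootPairing.reflection_apply_root, map_sub, map_smul, LinearMap.sub_apply,
    LinearMap.smul_apply, smul_eq_mul, RootPairing.root_coroot_eq_pairing]
  ring

theorem exists_root_pullback {u : N ≃ₗ[ℝ] N} (hu : u ∈ finiteWeylGroup P) (α : ι) :
    ∃ β, ∀ x, P.root' β x = P.root' α (u x) := by
  induction hu using Subgroup.closure_induction'' generalizing α with
  | mem u hu =>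
    obtain ⟨γ, rfl⟩ := hu
    exact ⟨_, root'_reflectionPerm γ α⟩
  | inv_mem u hu =>
    obtain ⟨γ, rfl⟩ := hu
    rw [RootPairing.coreflection_inv]
    exact ⟨_, root'_reflectionPerm γ α⟩
  | one => exact ⟨α, fun _ => rfl⟩
  | mul u v hu hv ihu ihv =>
    obtain ⟨β, hβ⟩ := ihu α
    obtain ⟨γ, hγ⟩ := ihv β
    exact ⟨γ, fun x => by rw [hγ, hβ]; rfl⟩

variable {b}

theorem root'_pos_of_forall_pos {x : N} (hx : ∀ i : b.support, 0 < P.root' i x) {α : ι}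
    (hα : b.IsPos α) : 0 < P.root' α x := by
  obtain ⟨i, hi⟩ := exists_one_le_coeff hα
  rw [root'_eq_sum_coeff b]
  exact Finset.sum_pos' (fun j _ => mul_nonneg (coeff_nonneg hα j) (hx j).le)
    ⟨i, Finset.mem_univ _, mul_pos (by linarith) (hx i)⟩

theorem root'_lt_of_forall_lt {x : N} {r : ℝ} (hr : 0 ≤ r)
    (hx : ∀ i : b.support, P.root' i x < -r) {α : ι} (hα : b.IsPos α) : P.root' α x < -r := by
  obtain ⟨i, hi⟩ := exists_one_le_coeff hα
  have h1 : coeff b α i * -P.root' i x ≤ ∑ j, coeff b α j * -P.root' j x :=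
    Finset.single_le_sum (f := fun j : b.support => coeff b α j * -P.root' j x)
      (fun j _ => mul_nonneg (coeff_nonneg hα j) (by have := hx j; linarith)) (Finset.mem_univ i)
  have h2 : -P.root' i x ≤ coeff b α i * -P.root' i x :=
    le_mul_of_one_le_left (by have := hx i; linarith) hi
  have h3 : P.root' α x = -∑ j, coeff b α j * -P.root' j x := by
    rw [root'_eq_sum_coeff b]
    simp
  have := hx i
  linarith

theorem root'_neg_of_not_isPos {x : N} (hx : ∀ i : b.support, 0 < P.root' i x) {α : ι}
    (hα : ¬ b.IsPos α) : P.root' α x < 0 := by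
  have := root'_pos_of_forall_pos hx ((isPos_reflectionPerm_self_iff b α).2 hα)
  rw [root'_reflectionPerm_self] at this
  linarith

theorem root'_basePoint_pos (i : b.support) : 0 < P.root' i (basePoint b) :=
  (basePoint_mem b).1 i

/-- Every regular point can be moved into the fundamental Weyl chamber. -/
theorem exists_mem_weylChamber {p : N} (hp : ∀ α, P.root' α p ≠ 0) :
    ∃ u ∈ finiteWeylGroup P, u p ∈ weylChamber b := by
  induction hn : {α | b.IsPos α ∧ P.root' α p < 0}.ncard using Nat.strong_induction_on
    generalizing p with
  | _ n ih =>
    by_cases hmem : p ∈ weylChamber b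
    · exact ⟨1, one_mem _, hmem⟩
    · simp only [weylChamber, Set.mem_ofPred_eq, not_forall, not_lt] at hmem
      obtain ⟨i, hi⟩ := hmem
      have hi' : P.root' i p < 0 := lt_of_le_of_ne hi (hp i)
      have hmemu : P.coreflection i ∈ finiteWeylGroup P := Subgroup.subset_closure ⟨_, rfl⟩
      -- A simple reflection permutes the positive roots other than its own, so the count drops by
      -- at least `α_i`.
      have hlt : {α | b.IsPos α ∧ P.root' α (P.coreflection i p) < 0}.ncard < n := by
        rw [← hn, ← Set.ncard_image_of_injective _ (P.reflectionPerm i).injective]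
        refine lt_of_le_of_lt (Set.ncard_le_ncard (t := {α | b.IsPos α ∧ P.root' α p < 0} \
          {(i : ι)}) ?_ (Set.toFinite _))
          (Set.ncard_sdiff_singleton_lt_of_mem
            ⟨RootPairing.Base.isPos_of_mem_support i.2, hi'⟩ (Set.toFinite _))
        rintro _ ⟨α, ⟨h1, h2⟩, rfl⟩
        rw [← root'_reflectionPerm] at h2
        have hne : α ≠ i := by
          rintro rfl
          rw [root'_reflectionPerm_self] at h2
          linarith
        refine ⟨⟨h1.reflectionPerm i.2 hne, h2⟩, fun he => ?_⟩
        have he' : α = P.reflectionPerm i i := by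
          rw [← P.reflectionPerm_self i α, Set.mem_singleton_iff.1 he]
        rw [he', isPos_reflectionPerm_self_iff] at h1
        exact h1 (RootPairing.Base.isPos_of_mem_support i.2)
      obtain ⟨u, hu, hup⟩ := ih _ hlt (p := P.coreflection i p)
        (fun α => by rw [← root'_reflectionPerm]; exact hp _) rfl
      exact ⟨u * P.coreflection i, mul_mem hu hmemu, hup⟩

/-- The sign of a root is constant on a Weyl chamber, so one point decides where the whole chamber
goes. -/
theorem mem_oppositeWeylChamber_iff_of_mem {u : N ≃ₗ[ℝ] N} (hu : u ∈ finiteWeylGroup P)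
    (h : u (basePoint b) ∈ oppositeWeylChamber b) (x : N) :
    u x ∈ oppositeWeylChamber b ↔ x ∈ weylChamber b := by
  constructor
  · intro hx i
    obtain ⟨β, hβ⟩ := exists_root_pullback (inv_mem hu) i
    have h1 : ∀ y, P.root' β (u y) = P.root' i y := fun y => by
      rw [hβ, ← LinearEquiv.mul_apply, inv_mul_cancel]; rfl
    have hneg : ∀ y, u y ∈ oppositeWeylChamber b → ∀ j : b.support, 0 < P.root' j (-u y) :=
      fun y hy j => by rw [map_neg]; exact neg_pos.2 (hy j)
    have hβ' : ¬ b.IsPos β := by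
      intro hβ'
      have h2 := root'_pos_of_forall_pos (hneg _ h) hβ'
      rw [map_neg, h1] at h2
      have := root'_basePoint_pos i
      linarith
    have h3 := root'_neg_of_not_isPos (hneg _ hx) hβ'
    rw [map_neg, h1] at h3
    linarith
  · intro hx i
    obtain ⟨β, hβ⟩ := exists_root_pullback hu i
    have h0 := h i
    rw [← hβ] at h0 ⊢
    refine root'_neg_of_not_isPos hx fun hp => ?_
    have := root'_pos_of_forall_pos (b := b) root'_basePoint_pos hp
    linarith

variable (b) in
-- Moving the negative of a point of `C_0` into `C_0` produces the element `w_0`.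
theorem exists_longest : ∃ u ∈ finiteWeylGroup P, ∀ x,
    u x ∈ oppositeWeylChamber b ↔ x ∈ weylChamber b := by
  obtain ⟨u, hu, hup⟩ := exists_mem_weylChamber (b := b) (p := -basePoint b) (fun α => by
    rw [map_neg, neg_ne_zero]
    have := affEval_ne_zero (basePoint_mem b) (α, 0)
    simpa [affEval] using this)
  refine ⟨u, hu, mem_oppositeWeylChamber_iff_of_mem hu fun i => ?_⟩
  have := hup i
  rw [map_neg, map_neg] at this
  linarith

variable (b) in
/-- The sum of the fundamental coweights. -/
def coweightSum : N := ∑ i, fundamentalCoweight b i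

theorem coweightSum_mem : coweightSum b ∈ coweightLattice b :=
  sum_mem fun i _ => AddSubgroup.subset_closure ⟨i, rfl⟩

theorem root'_coweightSum (α : ι) : ∃ k : ℤ, P.root' α (coweightSum b) = k := by
  obtain ⟨f, hf, -, -⟩ := exists_coeff_eq b α
  refine ⟨∑ i, f i, ?_⟩
  simp [coweightSum, root'_fundamentalCoweight_eq_coeff, hf]

theorem root'_coweightSum_simple (i : b.support) : P.root' i (coweightSum b) = 1 := by
  classical
  simp only [coweightSum, map_sum, root'_fundamentalCoweight, Finsupp.single_apply]
  simp

variable (b) in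
/-- The subsector of `w_0 C_0` at depth `n`. -/
def deepSector (n : ℕ) : Set N := {x | ∀ i : b.support, P.root' i x < -n}

theorem deepSector_subset (n : ℕ) : deepSector b n ⊆ oppositeWeylChamber b :=
  fun x hx i => lt_of_lt_of_le (hx i) (by simp)

theorem mem_deepSector_iff (n : ℕ) (x : N) :
    x ∈ deepSector b n ↔ x + n • coweightSum b ∈ oppositeWeylChamber b := by
  refine forall_congr' fun i => ?_
  rw [map_add, map_nsmul, root'_coweightSum_simple, nsmul_eq_mul, mul_one]
  exact lt_neg_iff_add_neg

theorem isSector_deepSector (n : ℕ) : IsSector b (deepSector b n) := by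
  obtain ⟨u, hu, hux⟩ := exists_longest b
  refine ⟨-(n • coweightSum b), neg_mem (nsmul_mem coweightSum_mem n), u, hu, ?_⟩
  ext x
  rw [mem_deepSector_iff]
  constructor
  · intro hx
    refine ⟨u.symm (x + n • coweightSum b), ?_, by simp⟩
    rw [← hux, LinearEquiv.apply_symm_apply]
    exact hx
  · rintro ⟨y, hy, rfl⟩
    simpa using (hux y).2 hy

/-- The linear part of a sector inside `w_0 C_0` must carry `C_0` to `w_0 C_0`, since otherwise a
ray would leave; the translation part is absorbed by a large depth. -/
theorem exists_deepSector_subset {T : Set N} (hT : IsSector b T)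
    (hsub : T ⊆ oppositeWeylChamber b) : ∃ n, deepSector b n ⊆ T := by
  obtain ⟨μ, -, u, hu, rfl⟩ := hT
  have hbase : u (basePoint b) ∈ oppositeWeylChamber b := by
    intro j
    by_contra! hj
    obtain ⟨β, hβ⟩ := exists_root_pullback hu j
    have h0 : P.root' β (basePoint b) ≠ 0 := by
      have := affEval_ne_zero (basePoint_mem b) (β, 0)
      simpa [affEval] using this
    have hj' : 0 < P.root' j (u (basePoint b)) := by
      rw [← hβ] at hj ⊢
      exact lt_of_le_of_ne hj h0.symm
    set r := P.root' j (u (basePoint b))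
    -- This multiple of the direction raises `α_j` by `|⟨μ, α_j⟩| + 1`, enough to make it positive
    -- after translation by `μ`.
    have ht : 0 < (|P.root' j μ| + 1) / r := by positivity
    have hmem := hsub ⟨((|P.root' j μ| + 1) / r) • basePoint b, fun i => by
      rw [map_smul, smul_eq_mul]
      exact mul_pos ht (root'_basePoint_pos i), rfl⟩ j
    rw [map_add, map_smul, map_smul, smul_eq_mul] at hmem
    change (|P.root' j μ| + 1) / r * r + P.root' j μ < 0 at hmem
    rw [div_mul_cancel₀ _ hj'.ne'] at hmem
    have := neg_abs_le (P.root' j μ)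
    linarith
  obtain ⟨n, hn⟩ : ∃ n : ℕ, ∀ i : b.support, -P.root' i μ ≤ n := by
    obtain ⟨n, hn⟩ := exists_nat_ge (∑ i : b.support, |P.root' i μ|)
    refine ⟨n, fun i => (neg_le_abs _).trans (le_trans ?_ hn)⟩
    exact Finset.single_le_sum (f := fun i : b.support => |P.root' i μ|)
      (fun i _ => abs_nonneg _) (Finset.mem_univ i)
  refine ⟨n, fun x hx => ⟨u.symm (x - μ), ?_, by simp⟩⟩
  rw [← mem_oppositeWeylChamber_iff_of_mem hu hbase, LinearEquiv.apply_symm_apply]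
  intro i
  rw [map_sub]
  have := hx i
  have := hn i
  linarith

theorem alcove_sign {f : ι × ℤ} {y : affineWeylGroup P} {a a' : N} (ha : a ∈ alcove b y)
    (ha' : a' ∈ alcove b y) : affEval P f a < 0 ↔ affEval P f a' < 0 := by
  obtain ⟨z, hz, rfl⟩ := ha
  obtain ⟨z', hz', rfl⟩ := ha'
  obtain ⟨g, hg, -⟩ := exists_pullback y f
  rw [← hg, ← hg]
  exact affEval_neg_iff hz hz' g

theorem apply_basePoint_mem_alcove (y : affineWeylGroup P) :
    (y : N ≃ᵃ[ℝ] N) (basePoint b) ∈ alcove b y := ⟨_, basePoint_mem b, rfl⟩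

/-- The boundary of a deep sector consists of hyperplanes of the arrangement, and no alcove crosses
one. -/
theorem alcove_subset_deepSector_iff {y : affineWeylGroup P} {n : ℕ} {a : N}
    (ha : a ∈ alcove b y) : alcove b y ⊆ deepSector b n ↔ a ∈ deepSector b n := by
  refine ⟨fun h => h ha, fun h a' ha' i => ?_⟩
  have := (alcove_sign (f := ((i : ι), (n : ℤ))) ha ha').1 (by
    have := h i
    simp only [affEval]
    push_cast
    linarith)
  simp only [affEval] at this
  push_cast at this
  linarith

theorem exists_alcove_subset_deepSector (n : ℕ) :
    ∃ y : affineWeylGroup P, alcove b y ⊆ deepSector b n := by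
  -- Depth `n + 1` compensates for the values of the simple roots at the base point, which lie below
  -- `1`. The point stays regular because roots are integral on `coweightSum`.
  set p : N := basePoint b - ((n + 1 : ℕ) : ℝ) • coweightSum b with hp
  have hreg : IsRegularPoint P p := by
    rintro ⟨α, k⟩
    obtain ⟨l, hl⟩ := root'_coweightSum (b := b) α
    have := affEval_ne_zero (basePoint_mem b) (α, k - (n + 1) * l)
    rw [hp, affEval_sub_smul, hl]
    simp only [affEval] at this ⊢
    push_cast at this ⊢
    convert this using 1
    ring
  obtain ⟨L, z, hz, hpz⟩ := exists_listProd_mem (b := b) hreg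
  refine ⟨listProd b L, (alcove_subset_deepSector_iff (a := p) ⟨z, hz, hpz.symm⟩).2 fun i => ?_⟩
  have := (root'_mem_Ioo_of_mem (basePoint_mem b)
    (RootPairing.Base.isPos_of_mem_support i.2)).2
  rw [hp, map_sub, map_smul, root'_coweightSum_simple]
  push_cast
  simp only [smul_eq_mul, mul_one]
  linarith

variable (b) in
/-- The filter of the subsectors of `w_0 C_0`. -/
def sectorFilter : Filter (affineWeylGroup P) :=
  ⨅ n : ℕ, Filter.principal {y | alcove b y ⊆ deepSector b n}

theorem deepSector_antitone : Antitone (deepSector b) := by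
  intro n n' h x hx i
  have : (n : ℝ) ≤ n' := by exact_mod_cast h
  have := hx i
  linarith

theorem eventually_sectorFilter_iff {p : affineWeylGroup P → Prop} :
    (∀ᶠ y in sectorFilter b, p y) ↔ ∃ n, ∀ y, alcove b y ⊆ deepSector b n → p y := by
  have hb : (sectorFilter b).HasBasis (fun _ : ℕ => True)
      fun n => {y | alcove b y ⊆ deepSector b n} :=
    Filter.hasBasis_iInf_principal (directed_of_isDirected_le
      fun n n' h y (hy : alcove b y ⊆ deepSector b n') => hy.trans (deepSector_antitone h))
  simp [hb.eventually_iff]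

instance : (sectorFilter b).NeBot := by
  refine ⟨fun h => ?_⟩
  have : ∀ᶠ y in sectorFilter b, False := by rw [h]; exact Filter.eventually_bot
  obtain ⟨n, hn⟩ := eventually_sectorFilter_iff.1 this
  obtain ⟨y, hy⟩ := exists_alcove_subset_deepSector (b := b) n
  exact hn y hy

theorem eventually_alcove_subset {T : Set N} (hT : IsSector b T)
    (hsub : T ⊆ oppositeWeylChamber b) : ∀ᶠ y in sectorFilter b, alcove b y ⊆ T := by
  obtain ⟨n, hn⟩ := exists_deepSector_subset hT hsub
  exact eventually_sectorFilter_iff.2 ⟨n, fun y hy => hy.trans hn⟩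

theorem exists_isSector_of_eventually {p : affineWeylGroup P → Prop}
    (h : ∀ᶠ y in sectorFilter b, p y) :
    ∃ T, IsSector b T ∧ T ⊆ oppositeWeylChamber b ∧ ∀ y, alcove b y ⊆ T → p y := by
  obtain ⟨n, hn⟩ := eventually_sectorFilter_iff.1 h
  exact ⟨_, isSector_deepSector n, deepSector_subset n, hn⟩

theorem eventually_affEval_neg {f : ι × ℤ} (hf : b.IsPos f.1) :
    ∀ᶠ y : affineWeylGroup P in sectorFilter b, affEval P f ((y : N ≃ᵃ[ℝ] N) (basePoint b)) < 0 := by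
  refine eventually_sectorFilter_iff.2 ⟨f.2.toNat, fun y hy => ?_⟩
  have h1 := root'_lt_of_forall_lt (r := f.2.toNat) (by positivity)
    (hy (apply_basePoint_mem_alcove y)) hf
  have h2 : (f.2 : ℝ) ≤ f.2.toNat := by exact_mod_cast Int.self_le_toNat f.2
  simp only [affEval]
  linarith

theorem sameSide_iff {i : Node b} {x : affineWeylGroup P} {f : ι × ℤ}
    (hf : ∀ z, affEval P f ((x : N ≃ᵃ[ℝ] N) z) = affEval P (wall b i) z)
    (y : affineWeylGroup P) :
    SameSide i x y ↔ 0 < affEval P f ((y : N ≃ᵃ[ℝ] N) (basePoint b)) := by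
  rw [SameSide, length_lt_simple_mul_iff, ← hf, ← coe_mul_apply, mul_inv_cancel_left]

theorem exists_affineRoot_wall (i : Node b) (x : affineWeylGroup P) :
    ∃ f, ∀ z, affEval P f ((x : N ≃ᵃ[ℝ] N) z) = affEval P (wall b i) z := by
  obtain ⟨f, hf, -⟩ := exists_pullback x⁻¹ (wall b i)
  exact ⟨f, fun z => by rw [hf, coe_inv_apply_self]⟩

/-- An affine root that is nonpositive on `x` and nonnegative on `x s_i` defines the wall between
these alcoves. -/
theorem affEval_eq_neg_wall {f : ι × ℤ} {i : Node b} {x : affineWeylGroup P}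
    (h1 : ∀ a ∈ alcove b x, affEval P f a ≤ 0)
    (h2 : ∀ a ∈ alcove b (x * simpleReflection b i), 0 ≤ affEval P f a) (z : N) :
    affEval P (negRoot P f) ((x : N ≃ᵃ[ℝ] N) z) = affEval P (wall b i) z := by
  obtain ⟨g, hg, -⟩ := exists_pullback x (negRoot P f)
  have e1 := lt_of_le_of_ne (h1 _ (apply_basePoint_mem_alcove x)) (regular_apply_basePoint x f)
  have e2 := lt_of_le_of_ne (h2 _ (apply_basePoint_mem_alcove _))
    (regular_apply_basePoint (x * simpleReflection b i) f).symm
  rw [← hg, eq_wall_of_separates (f := g) (i := i)]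
  · rw [hg, affEval_negRoot]
    linarith
  · rw [hg, affEval_negRoot, ← coe_mul_apply]
    linarith

/-- The alcove `x` is on the negative side of the wall, and so is every sufficiently deep alcove. -/
theorem IsPositiveCrossing.eventually_sameSide {i : Node b} {x : affineWeylGroup P}
    (h : IsPositiveCrossing b x (x * simpleReflection b i)) :
    ∀ᶠ y in sectorFilter b, SameSide i x y := by
  obtain ⟨α, hα, k, h1, h2⟩ := h
  have hw := affEval_eq_neg_wall (f := (α, k)) h1 h2
  filter_upwards [eventually_affEval_neg (b := b) (f := (α, k)) hα] with y hy
  rw [sameSide_iff hw, affEval_negRoot]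
  linarith

theorem IsPositiveCrossing.eventually_not_sameSide {i : Node b} {x : affineWeylGroup P}
    (h : IsPositiveCrossing b (x * simpleReflection b i) x) :
    ∀ᶠ y in sectorFilter b, ¬ SameSide i x y := by
  have := IsPositiveCrossing.eventually_sameSide (i := i) (x := x * simpleReflection b i)
    (by rwa [mul_simple_mul_simple])
  exact this.mono fun y hy => sameSide_mul_simple_iff.1 hy

theorem not_isPositiveCrossing_and {i : Node b} {x : affineWeylGroup P}
    (h : IsPositiveCrossing b x (x * simpleReflection b i))
    (h' : IsPositiveCrossing b (x * simpleReflection b i) x) : False := by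
  obtain ⟨y, hy, hy'⟩ := (h.eventually_sameSide.and h'.eventually_not_sameSide).exists
  exact hy' hy

theorem isPositiveCrossing_or (i : Node b) (x : affineWeylGroup P) :
    IsPositiveCrossing b x (x * simpleReflection b i) ∨
      IsPositiveCrossing b (x * simpleReflection b i) x := by
  obtain ⟨f, hf⟩ := exists_affineRoot_wall i x
  have h1 : ∀ a ∈ alcove b x, 0 < affEval P f a := by
    rintro _ ⟨z, hz, rfl⟩
    rw [hf]
    exact (mem_fundamentalAlcove_iff b z).1 hz i
  have h2 : ∀ a ∈ alcove b (x * simpleReflection b i), affEval P f a < 0 := by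
    rintro _ ⟨z, hz, rfl⟩
    rw [coe_mul_apply, hf, simpleReflection_eq_reflOf, affEval_reflOf_self]
    exact neg_neg_iff_pos.2 ((mem_fundamentalAlcove_iff b z).1 hz i)
  by_cases hp : b.IsPos f.1
  · exact Or.inr ⟨f.1, hp, f.2, fun a ha => (h2 a ha).le, fun a ha => (h1 a ha).le⟩
  · refine Or.inl ⟨_, (isPos_reflectionPerm_self_iff b f.1).2 hp, -f.2, fun a ha => ?_,
      fun a ha => ?_⟩
    · have := affEval_negRoot (P := P) f a
      have := h1 a ha
      change affEval P (negRoot P f) a ≤ 0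
      linarith
    · have := affEval_negRoot (P := P) f a
      have := h2 a ha
      change 0 ≤ affEval P (negRoot P f) a
      linarith

theorem eventually_sameSide_or (x : affineWeylGroup P) (i : Node b) :
    (∀ᶠ y in sectorFilter b, SameSide i x y) ∨ ∀ᶠ y in sectorFilter b, ¬ SameSide i x y :=
  (isPositiveCrossing_or i x).imp IsPositiveCrossing.eventually_sameSide
    IsPositiveCrossing.eventually_not_sameSide

/-- The direction of the crossing separates the first rule from the other two, and the vanishing of
the label separates those. -/
theorem IsLabelledStep.unique {q : Node b → Type*} [∀ i, Zero (q i)] {i : Node b}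
    {x y y' : affineWeylGroup P} {z : q i} (h : IsLabelledStep b q i x y z)
    (h' : IsLabelledStep b q i x y' z) : y = y' := by
  rcases h with ⟨rfl, h⟩ | ⟨rfl, h, hz⟩ | ⟨rfl, h, hz⟩ <;>
    rcases h' with ⟨rfl, h'⟩ | ⟨rfl, h', hz'⟩ | ⟨rfl, h', hz'⟩
  · rfl
  · exact (not_isPositiveCrossing_and h h').elim
  · rfl
  · exact (not_isPositiveCrossing_and h' h).elim
  · rfl
  · exact absurd hz' hz
  · rfl
  · exact absurd hz hz'
  · rfl

end Sectors

end AffineBuilding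

end

noncomputable section

namespace AffineBuilding

set_option linter.unusedSectionVars false

/-! ### The sector retraction and the labelling of neighbours -/

namespace Building

namespace Marking

variable {ι M N : Type*} [AddCommGroup M] [Module ℝ M] [AddCommGroup N] [Module ℝ N]
  {P : RootPairing ι ℝ M N} [P.IsRootSystem] {b : P.Base}
  [Finite ι] [P.IsCrystallographic] [P.IsReduced] [P.IsIrreducible] [Nonempty ι]
  {V : Type*} {X : Building b V} {m : X.Marking}

variable (m) in
/-- The chambers of the fixed apartment. -/
def base (w : affineWeylGroup P) : Chamber X := (isTypedChart_emb (m := m)).chamber w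

theorem isIsometry_base : IsIsometry m.dist m.base := isTypedChart_emb.isIsometry

/-- Translates the definition through apartments and isomorphisms into isometries and the sector
filter. Completeness enters from right to left, where an isometry must give an apartment. -/
theorem retractsTo_iff (hX : X.IsComplete) (c : Chamber X) (w : affineWeylGroup P) :
    m.RetractsTo c.1 w ↔ RetractsAlong m.dist (sectorFilter b) m.base c w := by
  classical
  constructor
  · rintro ⟨A, hA, hcA, ⟨T, hT, hTsub, hAT⟩, f, hf, hfix, hfc⟩
    obtain ⟨y₀, hy₀⟩ := (eventually_alcove_subset hT hTsub).exists
    -- The chart is normalised at a chamber of the sector, which `f` fixes; by rigidity `F` is then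
    -- inverse to `f` on vertices.
    obtain ⟨F, hF, hFy⟩ := exists_isTypedChart (m := m) hA (m.base y₀).2 (hAT y₀ hy₀) y₀
    have hfix' : ∀ y, alcove b y ⊆ T → ∀ i, f (m.emb (vert b y i)) = m.emb (vert b y i) :=
      fun y hy i => hfix _ (mem_vertices_inf (hAT y hy) (m.isChart_emb.cell_mem y)
        (vert_mem_cell _ _ i) (vert_mem_cell _ _ i))
    have hFf : ∀ w i, f (F (vert b w i)) = m.emb (vert b w i) := fun w i =>
      (hF.isChart.comp hf).rigid m.isChart_emb (y := y₀) (fun j => by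
        rw [Function.comp_apply, hF.vert_eq isTypedChart_emb hFy, hfix' y₀ hy₀]) w i
    have hcell : ∀ w, (cell b F w).image f = cell b m.emb w := fun w => by
      ext x
      rw [Finset.mem_image, mem_cell]
      constructor
      · rintro ⟨y, hy, rfl⟩
        obtain ⟨i, rfl⟩ := mem_cell.1 hy
        exact ⟨i, (hFf w i).symm⟩
      · rintro ⟨i, rfl⟩
        exact ⟨_, vert_mem_cell F w i, hFf w i⟩
    refine ⟨hF.chamber, hF.isIsometry, ?_, (eventually_alcove_subset hT hTsub).mono ?_⟩
    · obtain ⟨v, hv⟩ := exists_cell_eq hA hF.isChart c.2 hcA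
      have h1 := hcell v
      rw [hv] at h1
      have h2 : v = w := m.isChart_emb.cell_injective (h1.symm.trans hfc)
      exact Subtype.ext (h2 ▸ hv)
    · intro y hy
      obtain ⟨v, hv⟩ := exists_cell_eq hA hF.isChart (m.base y).2 (hAT y hy)
      refine Subtype.ext (cell_congr fun i => ?_)
      have h2 : F (vert b v i) = m.emb (vert b y i) := hF.vert_eq isTypedChart_emb hv i
      have h3 := hFf v i
      rw [h2, hfix' y hy] at h3
      rw [m.isChart_emb.inj h3, h2, m.isChart_emb.inj h3]
  · rintro ⟨φ, hφ, rfl, hev⟩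
    obtain ⟨T, hT, hTsub, hTy⟩ := exists_isSector_of_eventually hev
    obtain ⟨y₀, hy₀⟩ := (eventually_alcove_subset hT hTsub).exists
    obtain ⟨A, F, hF, hFφ⟩ := exists_isTypedChart_of_isIsometry hX hφ
    have hcell : ∀ y, alcove b y ⊆ T → cell b F y = m.chamberAt y := fun y hy => by
      rw [hFφ, hTy y hy]
      rfl
    obtain ⟨g, hg, hfix, hgF⟩ := exists_transition m.mem_apartments hF.mem m.isChart_emb
      hF.isChart (y := y₀) fun i => (hF.vert_eq isTypedChart_emb (hcell y₀ hy₀) i).symm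
    refine ⟨A, hF.mem, by rw [← hFφ]; exact hF.isChart.cell_mem w,
      ⟨T, hT, hTsub, fun y hy => by rw [← hcell y hy]; exact hF.isChart.cell_mem y⟩, g, hg,
      by rwa [inf_comm], ?_⟩
    rw [← hFφ]
    ext x
    rw [Finset.mem_image, chamberAt_eq_cell, mem_cell]
    constructor
    · rintro ⟨y, hy, rfl⟩
      obtain ⟨i, rfl⟩ := mem_cell.1 hy
      exact ⟨i, (hgF w i).symm⟩
    · rintro ⟨i, rfl⟩
      exact ⟨_, vert_mem_cell F w i, hgF w i⟩

theorem retractsAlong_retraction (hX : X.IsComplete) (c : Chamber X) :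
    RetractsAlong m.dist (sectorFilter b) m.base c (m.retraction c.1) := by
  have h : ∃ w, m.RetractsTo c.1 w := by
    obtain ⟨w, hw⟩ := exists_retractsAlong isWeylDistance isIsometry_base
      (fun x i => eventually_sameSide_or (b := b) x i) c
    exact ⟨w, (retractsTo_iff hX c w).2 hw⟩
  rw [← retractsTo_iff hX, retraction, dif_pos h]
  exact h.choose_spec

theorem retraction_eq (hX : X.IsComplete) {c : Chamber X} {w : affineWeylGroup P}
    (h : RetractsAlong m.dist (sectorFilter b) m.base c w) : m.retraction c.1 = w :=
  (retractsAlong_retraction hX c).unique h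

theorem retraction_chamberAt_one (hX : X.IsComplete) : m.retraction (m.chamberAt 1) = 1 :=
  retraction_eq hX (c := m.base 1)
    ⟨m.base, isIsometry_base, rfl, Filter.Eventually.of_forall fun _ => rfl⟩

instance : Nonempty b.support := b.support_nonempty.to_subtype

theorem isChamber_of_mem_neighbors {i : Node b} {c d : Finset V} (h : d ∈ m.neighbors i c) :
    IsChamber X.complex d := h.1.2.1

theorem mem_neighbors_iff {i : Node b} {c d : Chamber X} :
    d.1 ∈ m.neighbors i c.1 ↔ m.dist c d = simpleReflection b i := by
  change m.Adjacent i c.1 d.1 ∧ c.1 ≠ d.1 ↔ _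
  rw [adjacent_iff_dist, Ne, ← Subtype.ext_iff, ← isWeylDistance.eq_one_iff]
  constructor
  · rintro ⟨h1 | h1, h2⟩
    · exact absurd h1 h2
    · exact h1
  · intro h
    exact ⟨Or.inr h, by rw [h]; exact simpleReflection_ne_one i⟩

theorem exists_panel (i : Node b) (c : Chamber X) :
    ∃ p, IsPanel X.complex p ∧ m.HasCotype p i ∧ p ⊆ c.1 := by
  obtain ⟨-, -, p, h1, h2, h3, -⟩ := (adjacent_iff_dist (m := m) (i := i) (c := c) (d := c)).2
    (Or.inl (isWeylDistance.self c))
  exact ⟨p, h1, h2, h3⟩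

theorem mem_neighbors_iff_of_panel {i : Node b} {c : Chamber X} {p : Finset V}
    (hp : IsPanel X.complex p) (hpi : m.HasCotype p i) (hpc : p ⊆ c.1) (d : Finset V) :
    d ∈ m.neighbors i c.1 ↔ (IsChamber X.complex d ∧ p ⊆ d) ∧ d ≠ c.1 := by
  constructor
  · rintro ⟨h, hne⟩
    refine ⟨⟨h.2.1, fun x hx => ?_⟩, hne.symm⟩
    exact (adjacent_iff_vertices (d := ⟨d, h.2.1⟩)).1 h x (hpc hx) ((hpi _).1 ⟨x, hx, rfl⟩)
  · rintro ⟨⟨hd, hpd⟩, hne⟩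
    exact ⟨⟨c.2, hd, p, hp, hpi, hpc, hpd⟩, hne.symm⟩

/-- Regularity counts all chambers on a panel. Composing with a transposition makes the bijection
match `c` with `d`, after which both can be removed. -/
theorem nonempty_neighbors_equiv (hreg : m.IsRegular) (i : Node b) (c d : Chamber X) :
    Nonempty (m.neighbors i c.1 ≃ m.neighbors i d.1) := by
  classical
  obtain ⟨p, hp, hpi, hpc⟩ := exists_panel (m := m) i c
  obtain ⟨p', hp', hpi', hpd⟩ := exists_panel (m := m) i d
  obtain ⟨e⟩ := hreg i p p' hp hp' hpi hpi'
  let c' : {c // IsChamber X.complex c ∧ p ⊆ c} := ⟨c.1, c.2, hpc⟩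
  let d' : {c // IsChamber X.complex c ∧ p' ⊆ c} := ⟨d.1, d.2, hpd⟩
  let e' := e.trans (Equiv.swap (e c') d')
  have hcd : e' c' = d' := by simp [e']
  have key : ∀ {c : Chamber X} {p : Finset V} (hp : IsPanel X.complex p)
      (hpi : m.HasCotype p i) (hpc : p ⊆ c.1), Nonempty (m.neighbors i c.1 ≃
        {x : {c // IsChamber X.complex c ∧ p ⊆ c} // x ≠ ⟨c.1, c.2, hpc⟩}) := by
    intro c p hp hpi hpc
    refine ⟨(Equiv.subtypeEquivRight (mem_neighbors_iff_of_panel hp hpi hpc)).trans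
      ((Equiv.subtypeSubtypeEquivSubtypeInter _ _).symm.trans
        (Equiv.subtypeEquivRight fun x => ?_))⟩
    rw [Ne, Ne, Subtype.ext_iff]
  obtain ⟨e₁⟩ := key hp hpi hpc
  obtain ⟨e₂⟩ := key hp' hpi' hpd
  refine ⟨e₁.trans ((e'.subtypeEquiv fun x => ?_).trans e₂.symm)⟩
  change x ≠ c' ↔ e' x ≠ d'
  rw [← hcd, e'.injective.ne_iff]

/-- The local form of the theorem: at a positive crossing any labelling works, at a negative one the
unique neighbour retracting across the wall must be labelled `0`. -/
theorem exists_labelling (hX : X.IsComplete) {q : Node b → Type*} [∀ i, Zero (q i)]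
    (i : Node b) (c : Chamber X) (hq : Nonempty (m.neighbors i c.1 ≃ q i)) :
    ∃ e : m.neighbors i c.1 ≃ q i, ∀ d, IsLabelledStep b q i (m.retraction c.1)
      (m.retraction d.1) (e d) := by
  classical
  obtain ⟨e⟩ := hq
  have hc := retractsAlong_retraction (m := m) hX c
  set x := m.retraction c.1
  have hdist : ∀ d : m.neighbors i c.1,
      m.dist c ⟨d.1, isChamber_of_mem_neighbors d.2⟩ = simpleReflection b i :=
    fun d => mem_neighbors_iff.1 d.2
  rcases isPositiveCrossing_or i x with h | h
  · refine ⟨e, fun d => Or.inl ⟨?_, h⟩⟩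
    exact retraction_eq hX (hc.of_sameSide isWeylDistance h.eventually_sameSide (hdist d))
  · obtain ⟨c', h1, h2, h3⟩ := hc.exists_of_not_sameSide isWeylDistance h.eventually_not_sameSide
    let d' : m.neighbors i c.1 := ⟨c'.1, mem_neighbors_iff.2 h1⟩
    -- The transposition gives the exceptional neighbour the label `0`, so by injectivity no other
    -- neighbour has it.
    refine ⟨e.trans (Equiv.swap (e d') 0), fun d => ?_⟩
    by_cases hd : d = d'
    · refine Or.inr (Or.inr ⟨?_, h, by simp [hd]⟩)
      rw [hd]
      exact retraction_eq hX h2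
    · refine Or.inr (Or.inl ⟨?_, h, ?_⟩)
      · refine retraction_eq hX (c := ⟨d.1, isChamber_of_mem_neighbors d.2⟩)
          (h3 _ (hdist d) fun he => hd (Subtype.ext (show d.1 = c'.1 from Subtype.ext_iff.1 he)))
      · have h0 : (e.trans (Equiv.swap (e d') 0)) d' = 0 := by simp
        exact fun he => hd ((e.trans (Equiv.swap (e d') 0)).injective (he.trans h0.symm))

end Marking

end Building

theorem LabelledWalk.ext {ι M N : Type*} [AddCommGroup M] [Module ℝ M] [AddCommGroup N]
    [Module ℝ N] {P : RootPairing ι ℝ M N} [P.IsRootSystem] [Nonempty ι] {b : P.Base}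
    {q : Node b → Type*} [∀ i, Zero (q i)] {l : ℕ} {word : Fin l → Node b}
    {v : affineWeylGroup P} {x y : LabelledWalk b q word v}
    (h : ∀ k, x.alcove k = y.alcove k) (h' : ∀ k, x.label k = y.label k) : x = y := by
  cases x
  cases y
  obtain rfl := funext h
  obtain rfl := funext h'
  rfl

end AffineBuilding

end

/-! ### The bijection between galleries and labelled walks -/

open AffineBuilding AffineBuilding.Building AffineBuilding.Building.Marking in
theorem propositionA3 {ι M N V : Type*} [Finite ι] [Nonempty ι]
    [AddCommGroup M] [Module ℝ M] [AddCommGroup N] [Module ℝ N]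
    (P : RootPairing ι ℝ M N) [P.IsRootSystem] [P.IsCrystallographic] [P.IsReduced]
    [P.IsIrreducible] (b : P.Base)
    (X : AffineBuilding.Building b V) (hX : X.IsComplete) (m : X.Marking) (hreg : m.IsRegular)
    (q : AffineBuilding.Node b → Type*) [∀ i, Zero (q i)]
    (c₀ : Finset V) (hc₀ : AffineBuilding.IsChamber X.complex c₀)
    (hq : ∀ i, Nonempty (m.neighbors i c₀ ≃ q i))
    {l : ℕ} (word : Fin l → AffineBuilding.Node b) (hword : AffineBuilding.IsReducedWord b word)
    (v : AffineBuilding.affineWeylGroup P) :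
    ∃ e : m.galleries word v ≃ AffineBuilding.LabelledWalk b q word v,
      ∀ (g : m.galleries word v) (k : Fin (l + 1)),
        (e g).alcove k = m.retraction (g.1 k) := by
  have hlab : ∀ (c : Chamber X) (i : Node b), ∃ e : m.neighbors i c.1 ≃ q i,
      ∀ d, IsLabelledStep b q i (m.retraction c.1) (m.retraction d.1) (e d) := fun c i =>
    exists_labelling hX i c (by
      obtain ⟨e₁⟩ := nonempty_neighbors_equiv hreg i c ⟨c₀, hc₀⟩
      obtain ⟨e₂⟩ := hq i
      exact ⟨e₁.trans e₂⟩)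
  choose e he using hlab
  let toWalk : m.galleries word v → LabelledWalk b q word v := fun g =>
    { alcove := fun k => m.retraction (g.1 k)
      label := fun k => e ⟨g.1 k.castSucc, g.2.1.1 _⟩ (word k) ⟨g.1 k.succ, g.2.1.2 k⟩
      start := by rw [g.2.2.1, retraction_chamberAt_one hX]
      finish := g.2.2.2
      step := fun k => he ⟨g.1 k.castSucc, g.2.1.1 _⟩ (word k) ⟨g.1 k.succ, g.2.1.2 k⟩ }
  have hinj : Function.Injective toWalk := by
    intro g g' h
    have hlabel : ∀ k, (toWalk g).label k = (toWalk g').label k := fun k => by rw [h]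
    have key : ∀ {c c' : Chamber X} {i : Node b} (d : m.neighbors i c.1)
        (d' : m.neighbors i c'.1), c = c' → e c i d = e c' i d' → d.1 = d'.1 := by
      rintro c c' i d d' rfl h
      rw [(e c i).injective h]
    refine Subtype.ext (funext fun k => ?_)
    induction k using Fin.induction with
    | zero => rw [g.2.2.1, g'.2.2.1]
    | succ k ih => exact key _ _ (Subtype.ext ih) (hlabel k)
  have hsurj : Function.Surjective toWalk := by
    intro x
    -- The gallery is rebuilt from the labels alone; the alcoves of the walk are recovered
    -- afterwards.
    let c : Fin (l + 1) → Chamber X := fun k => Fin.induction (motive := fun _ => Chamber X)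
      (m.base 1) (fun k c => ⟨((e c (word k)).symm (x.label k)).1,
        isChamber_of_mem_neighbors ((e c (word k)).symm (x.label k)).2⟩) k
    have hsucc : ∀ k : Fin l,
        (c k.succ).1 = ((e (c k.castSucc) (word k)).symm (x.label k)).1 := fun k => rfl
    have hret : ∀ k, m.retraction (c k).1 = x.alcove k := by
      intro k
      induction k using Fin.induction with
      | zero => exact (retraction_chamberAt_one hX).trans x.start.symm
      | succ k ih =>
        have h1 := he (c k.castSucc) (word k) ((e (c k.castSucc) (word k)).symm (x.label k))
        rw [Equiv.apply_symm_apply, ih, ← hsucc] at h1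
        -- Both steps start at the same alcove with the same label, so they end at the same alcove.
        exact h1.unique (x.step k)
    have hmem : ∀ k : Fin l, (c k.succ).1 ∈ m.neighbors (word k) (c k.castSucc).1 :=
      fun k => by rw [hsucc]; exact Subtype.prop _
    refine ⟨⟨fun k => (c k).1, ⟨fun k => (c k).2, hmem⟩, rfl,
      (hret _).trans x.finish⟩, LabelledWalk.ext hret fun k => ?_⟩
    change e (c k.castSucc) (word k) ⟨(c k.succ).1, hmem k⟩ = x.label k
    rw [← Equiv.eq_symm_apply]
    exact Subtype.ext (hsucc k)
  exact ⟨Equiv.ofBijective toWalk ⟨hinj, hsurj⟩, fun g k => rfl⟩
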